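/- **Setting.** A *probabilistic nondeterministic transition system* (PNTS) is a pair $(S,\rightarrow)$ with $S$ a set (of arbitrary cardinality) and ${\rightarrow}\subseteq S\times\mathcal D(S)$, where $\mathcal D(S)=\{d:S\to[0,1]\mid\sum_{s}d(s)=1\}$. Write $s\not\rightarrow$ if there is no $d$ with $s\rightarrow d$, and $s\leadsto t$ if $s\rightarrow d$ for some $d$ with $d(t)>0$. A *maximal path* is a nonempty finite or infinite sequence $s_0.s_1.\dots$ of states with $s_i\leadsto s_{i+1}$ for consecutive entries which is either infinite or ends in a state $s_n$ that has no $\leadsto$-successor. The set $\mathrm P$ of maximal paths has the topology generated by the sets $U_{s_0\dots s_n}$ of all maximal paths extending $s_0.\dots.s_n$. A *scheduler* is a partial function $\sigma$ from nonempty finite sequences of states to $\mathcal D(S)$ such that $\sigma(s_0\dots s_n)$ is undefined iff $s_n\not\rightarrow$, and $s_n\rightarrow\sigma(s_0\dots s_n)$ otherwise. For a state $s$ and a scheduler $\sigma$, $m^s_\sigma$ is the Borel probability measure on $\mathrm P$ determined by $m^s_\sigma(U_{s_0\dots s_n})=\prod_{i<n}\sigma(s_0\dots s_i)(s_{i+1})$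 if $s_0=s$ (a factor being $0$ where $\sigma$ is undefined) and $m^s_\sigma(U_{s_0\dots s_n})=0$ if $s_0\ne s$. **PCTL.** State-formulas and path-formulas over a set of propositional letters $P$ are given by $$\phi::=\mathrm{true}\mid P\mid\neg\phi\mid\phi\vee\phi\mid\exists\psi\mid\forall\psi\mid\mathbb P^{\exists}_{\rtimes q}\psi\mid\mathbb P^{\forall}_{\rtimes q}\psi,\qquad \psi::=\circ\phi\mid\phi_1\,\mathcal U\,\phi_2,$$ with $q\in\mathbb Q\cap[0,1]$ and ${\rtimes}\in\{>,\ge\}$. A PCTL-interpretation $\rho$ assigns to each letter a subset of $S$. The sets $(\!|\phi|\!)_\rho\subseteq S$ and $(\!|\psi|\!)_\rho\subseteq\mathrm P$ are defined as usual for $\mathrm{true},P,\neg,\vee$; $s\in(\!|\exists\psi|\!)_\rho$ (resp. $s\in(\!|\forall\psi|\!)_\rho$) iff some (resp. every) maximal path starting at $s$ is in $(\!|\psi|\!)_\rho$; $s\in(\!|\mathbb P^{\exists}_{\rtimes q}\psi|\!)_\rho$ iff $\sup_\sigma m^s_\sigma((\!|\psi|\!)_\rho)\rtimes q$, and $s\in(\!|\mathbb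 P^{\forall}_{\rtimes q}\psi|\!)_\rho$ iff $\inf_\sigma m^s_\sigma((\!|\psi|\!)_\rho)\rtimes q$, with $\sigma$ ranging over all schedulers; $\vec s\in(\!|\circ\phi|\!)_\rho$ iff $\vec s$ has at least two entries and $s_1\in(\!|\phi|\!)_\rho$; $\vec s\in(\!|\phi_1\mathcal U\phi_2|\!)_\rho$ iff there is an entry $s_n\in(\!|\phi_2|\!)_\rho$ with $s_m\in(\!|\phi_1|\!)_\rho$ for all $m<n$. **Łukasiewicz modal $\mu$-calculus.** Formulas are $$\phi::=X\mid P\mid\overline P\mid q\,\phi\mid\phi\sqcup\phi\mid\phi\sqcap\phi\mid\phi\oplus\phi\mid\phi\odot\phi\mid\Diamond\phi\mid\Box\phi\mid\mu X.\phi\mid\nu X.\phi$$ with $q\in\mathbb Q\cap[0,1]$ and $X$ in a countably infinite set of variables. For an interpretation $\rho$ of letters and variables by functions $S\to[0,1]$, $[\![\phi]\!]_\rho:S\to[0,1]$ is given by: $X,P$ denote $\rho(X),\rho(P)$; $\overline P$ denotes $1-\rho(P)$; $q\,\phi$ is multiplication by $q$; $\sqcup,\sqcap$ are pointwise $\max,\min$;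 $\oplus$ is $\min\{1,a+b\}$; $\odot$ is $\max\{0,a+b-1\}$; $[\![\Diamond\phi]\!]_\rho(x)=\sup_{x\rightarrow d}\sum_y d(y)[\![\phi]\!]_\rho(y)$ and $[\![\Box\phi]\!]_\rho(x)=\inf_{x\rightarrow d}\sum_y d(y)[\![\phi]\!]_\rho(y)$, computed in $[0,1]$ (so $\sup\emptyset=0$, $\inf\emptyset=1$); $\mu X.\phi$ and $\nu X.\phi$ are the least and the greatest fixed point of $f\mapsto[\![\phi]\!]_{\rho[f/X]}$. Put $\underline 1=\nu X.X$ and $\underline q=q\,\underline 1$. Let $\mathrm{negate}(\phi)$ be obtained by fixing variables, exchanging $P\leftrightarrow\overline P$, $\sqcup\leftrightarrow\sqcap$, $\oplus\leftrightarrow\odot$, $\Diamond\leftrightarrow\Box$, $\mu\leftrightarrow\nu$ recursively, with $\mathrm{negate}(q\,\phi)=(q\,\mathrm{negate}(\phi))\oplus\underline{1-q}$. Put $\boxdot\phi=\Box\phi\sqcap\Diamond\underline1$ and, with $Y$ not appearing in the formula under the modality, $$\mathbb P_{>0}\phi=\mu Y.(Y\oplus\phi),\quad \mathbb P_{=1}\phi=\nu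 Y.(Y\odot\phi),\quad \mathbb P_{>q}\phi=\mathbb P_{>0}(\phi\odot\underline{1-q})\ (0<q\le1),\quad \mathbb P_{\ge q}\phi=\mathbb P_{=1}(\phi\oplus\underline{1-q})\ (0\le q<1),$$ and $\mathbb P_{\ge1}=\mathbb P_{=1}$. **Encoding.** $\mathbf E$ maps PCTL state-formulas to closed formulas of the Łukasiewicz modal $\mu$-calculus: - $\mathbf E(P)=P$, $\mathbf E(\mathrm{true})=\underline1$, $\mathbf E(\phi_1\vee\phi_2)=\mathbf E(\phi_1)\sqcup\mathbf E(\phi_2)$, $\mathbf E(\neg\phi)=\mathrm{negate}(\mathbf E(\phi))$; - $\mathbf E(\exists\circ\phi)=\mathbb P_{>0}(\Diamond\mathbf E(\phi))$, $\mathbf E(\forall\circ\phi)=\mathbb P_{=1}(\boxdot\mathbf E(\phi))$; - $\mathbf E(\exists(\phi_1\mathcal U\phi_2))=\mu X.\big(\mathbf E(\phi_2)\sqcup(\mathbf E(\phi_1)\sqcap\mathbb P_{>0}(\Diamond X))\big)$, $\mathbf E(\forall(\phi_1\mathcal U\phi_2))=\mu X.\big(\mathbf E(\phi_2)\sqcup(\mathbf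 E(\phi_1)\sqcap\mathbb P_{=1}(\boxdot X))\big)$; - $\mathbf E(\mathbb P^\exists_{\rtimes q}(\circ\phi))=\mathbb P_{\rtimes q}(\Diamond\mathbf E(\phi))$, $\mathbf E(\mathbb P^\forall_{\rtimes q}(\circ\phi))=\mathbb P_{\rtimes q}(\boxdot\mathbf E(\phi))$; - $\mathbf E(\mathbb P^\exists_{\rtimes q}(\phi_1\mathcal U\phi_2))=\mathbb P_{\rtimes q}\big(\mu X.(\mathbf E(\phi_2)\sqcup(\mathbf E(\phi_1)\sqcap\Diamond X))\big)$, $\mathbf E(\mathbb P^\forall_{\rtimes q}(\phi_1\mathcal U\phi_2))=\mathbb P_{\rtimes q}\big(\mu X.(\mathbf E(\phi_2)\sqcup(\mathbf E(\phi_1)\sqcap\boxdot X))\big)$. **Theorem.** For every PNTS $(S,\rightarrow)$, every PCTL-interpretation $\rho$ of the propositional letters (subsets of $S$ being identified with their $\{0,1\}$-valued characteristic functions), every interpretation of the variables, every PCTL state-formula $\phi$ and every state $s\in S$, $$(\!|\phi|\!)_\rho(s)=[\![\mathbf E(\phi)]\!]_\rho(s).$$ -/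

import Mathlib

open MeasureTheory Set
open scoped ENNReal

namespace LukPCTL

noncomputable section

universe u v

/-! ## Probabilistic nondeterministic transition systems -/

/-- A probabilistic nondeterministic transition system on the state set `S`: an arbitrary
relation between states and discrete probability distributions on `S`. -/
structure PNTS (S : Type u) where
  trans : S → PMF S → Prop

/-- The edge relation of the underlying graph: `s ⇝ t` iff `s → d` with `d t > 0`. -/
def PNTS.LeadsTo {S : Type u} (L : PNTS S) (s t : S) : Prop :=
  ∃ d : PMF S, L.trans s d ∧ 0 < d t

/-- Maximal paths of the underlying graph: nonempty finite or infinite sequences of states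
(`state n = none` means that the sequence has at most `n` entries) whose consecutive entries are
related by `⇝` and which, if finite, end in a state without successors. -/
@[ext] structure MaxPath {S : Type u} (L : PNTS S) where
  state : ℕ → Option S
  nonempty : state 0 ≠ none
  initial : ∀ n, state n = none → state (n + 1) = none
  step : ∀ n s t, state n = some s → state (n + 1) = some t → L.LeadsTo s t
  maximal : ∀ n s, state n = some s → state (n + 1) = none → ∀ t, ¬ L.LeadsTo s t

/-- The basic open set of all maximal paths extending the finite sequence `x 0, …, x n`. -/
def cyl {S : Type u} (L : PNTS S) {n : ℕ} (x : Fin (n + 1) → S) : Set (MaxPath L) :=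
  {w | ∀ i : Fin (n + 1), w.state i = some (x i)}

instance {S : Type u} (L : PNTS S) : TopologicalSpace (MaxPath L) :=
  TopologicalSpace.generateFrom {U | ∃ (n : ℕ) (x : Fin (n + 1) → S), U = cyl L x}

instance {S : Type u} (L : PNTS S) : MeasurableSpace (MaxPath L) := borel _

instance {S : Type u} (L : PNTS S) : BorelSpace (MaxPath L) := ⟨rfl⟩

/-- A scheduler: a partial function from nonempty finite sequences `x 0, …, x n` of states to
distributions, undefined exactly when the last state has no transition, and otherwise choosing a
transition of the last state. -/
structure Scheduler {S : Type u} (L : PNTS S) where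
  choice : (n : ℕ) → (Fin (n + 1) → S) → Option (PMF S)
  eq_none_iff : ∀ n x, choice n x = none ↔ ∀ d, ¬ L.trans (x (Fin.last n)) d
  trans_of_eq_some : ∀ n x d, choice n x = some d → L.trans (x (Fin.last n)) d

/-- The probability that the scheduler moves to `t` after the history `x` (it is `0` if the
scheduler is undefined at `x`). -/
def Scheduler.prob {S : Type u} {L : PNTS S} (σ : Scheduler L) {n : ℕ} (x : Fin (n + 1) → S)
    (t : S) : ℝ≥0∞ :=
  (σ.choice n x).elim 0 (fun d => d t)

/-- The first `i + 1` entries of the sequence `x 0, …, x n`, for `i < n`. -/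
def initSeg {S : Type u} {n : ℕ} (x : Fin (n + 1) → S) (i : Fin n) : Fin ((i : ℕ) + 1) → S :=
  fun j => x (j.castLE (by omega))

/-- The property specifying the measure of the Markov run `(s, σ)`: it is a Borel probability
measure on the maximal paths that gives the basic open set of `x 0, …, x n` the mass
`∏ i < n, σ(x 0, …, x i)(x (i + 1))` if `x 0 = s`, and the mass `0` otherwise. -/
def IsPathMeasure {S : Type u} {L : PNTS S} (σ : Scheduler L) (s : S)
    (m : Measure (MaxPath L)) : Prop :=
  IsProbabilityMeasure m ∧
    ∀ (n : ℕ) (x : Fin (n + 1) → S),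
      (x 0 = s → m (cyl L x) = ∏ i : Fin n, σ.prob (initSeg x i) (x i.succ)) ∧
      (x 0 ≠ s → m (cyl L x) = 0)

/-! ### Existence of the path measure

Independent choices of a successor are made for all finite histories simultaneously, and the
path obtained by following these choices from `s` is a random maximal path. -/

section Existence

variable {S : Type u} {L : PNTS S} (σ : Scheduler L)

/-- The distribution of the successor of a history (`none` if there is no successor). -/
def Scheduler.next (p : Σ n : ℕ, (Fin (n + 1) → S)) : PMF (Option S) :=
  (σ.choice p.1 p.2).elim (PMF.pure none) (fun d => d.map some)

lemma Scheduler.next_some (n : ℕ) (x : Fin (n + 1) → S) (t : S) :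
    σ.next ⟨n, x⟩ (some t) = σ.prob x t := by
  unfold Scheduler.next Scheduler.prob
  cases h : σ.choice n x with
  | none => simp
  | some d =>
    simp only [Option.elim_some, PMF.map_apply, Option.some.injEq]
    rw [tsum_eq_single t]
    · simp
    · intro b hb
      simp [Ne.symm hb]

lemma Scheduler.mem_support_none {n : ℕ} {x : Fin (n + 1) → S}
    (h : none ∈ (σ.next ⟨n, x⟩).support) (t : S) : ¬ L.LeadsTo (x (Fin.last n)) t := by
  unfold Scheduler.next at h
  cases hc : σ.choice n x with
  | none =>
    rintro ⟨d, hd, -⟩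
    exact (σ.eq_none_iff n x).1 hc d hd
  | some d => simp [hc] at h

lemma Scheduler.mem_support_some {n : ℕ} {x : Fin (n + 1) → S} {t : S}
    (h : some t ∈ (σ.next ⟨n, x⟩).support) : L.LeadsTo (x (Fin.last n)) t := by
  rw [PMF.mem_support_iff, σ.next_some] at h
  unfold Scheduler.prob at h
  cases hc : σ.choice n x with
  | none => simp [hc] at h
  | some d =>
    simp only [hc, Option.elim_some] at h
    exact ⟨d, σ.trans_of_eq_some n x d hc, pos_iff_ne_zero.2 h⟩

open Classical in
/-- Replace an outcome of probability zero by one of positive probability. -/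
def Scheduler.fix (p : Σ n : ℕ, (Fin (n + 1) → S)) (o : Option S) : Option S :=
  if o ∈ (σ.next p).support then o else (σ.next p).support_nonempty.some

lemma Scheduler.fix_mem (p : Σ n : ℕ, (Fin (n + 1) → S)) (o : Option S) :
    σ.fix p o ∈ (σ.next p).support := by
  unfold Scheduler.fix
  split_ifs with h
  · exact h
  · exact (σ.next p).support_nonempty.some_mem

lemma Scheduler.fix_of_mem {p : Σ n : ℕ, (Fin (n + 1) → S)} {o : Option S}
    (h : o ∈ (σ.next p).support) : σ.fix p o = o := by
  simp [Scheduler.fix, h]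

/-- The history of length `n + 1` generated from `s` by the choices `ω`, if it exists. -/
def Scheduler.hist (s : S) (ω : (Σ n : ℕ, (Fin (n + 1) → S)) → Option S) :
    (n : ℕ) → Option (Fin (n + 1) → S)
  | 0 => some (fun _ => s)
  | n + 1 => (Scheduler.hist s ω n).bind fun x =>
      (σ.fix ⟨n, x⟩ (ω ⟨n, x⟩)).map fun t => (Fin.snoc x t : Fin (n + 1 + 1) → S)

variable (s : S) (ω : (Σ n : ℕ, (Fin (n + 1) → S)) → Option S)

lemma Scheduler.hist_succ {n : ℕ} {x : Fin (n + 1) → S} (h : σ.hist s ω n = some x) :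
    σ.hist s ω (n + 1) =
      (σ.fix ⟨n, x⟩ (ω ⟨n, x⟩)).map fun t => (Fin.snoc x t : Fin (n + 1 + 1) → S) := by
  simp [Scheduler.hist, h]

/-- The maximal path generated from `s` by the choices `ω`. -/
def Scheduler.path : MaxPath L where
  state n := (σ.hist s ω n).map fun x => x (Fin.last n)
  nonempty := by simp [Scheduler.hist]
  initial n h := by
    rw [Option.map_eq_none_iff] at h ⊢
    simp [Scheduler.hist, h]
  step n a b h h' := by
    obtain ⟨x, hx, rfl⟩ := Option.map_eq_some_iff.1 h
    rw [σ.hist_succ s ω hx] at h'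
    have hm := σ.fix_mem ⟨n, x⟩ (ω ⟨n, x⟩)
    cases ho : σ.fix ⟨n, x⟩ (ω ⟨n, x⟩) with
    | none => simp [ho] at h'
    | some t =>
      rw [ho] at hm h'
      simp only [Option.map_some, Fin.snoc_last, Option.some.injEq] at h'
      subst h'
      exact σ.mem_support_some hm
  maximal n a h h' := by
    obtain ⟨x, hx, rfl⟩ := Option.map_eq_some_iff.1 h
    rw [σ.hist_succ s ω hx] at h'
    have hm := σ.fix_mem ⟨n, x⟩ (ω ⟨n, x⟩)
    cases ho : σ.fix ⟨n, x⟩ (ω ⟨n, x⟩) with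
    | none =>
      rw [ho] at hm
      exact σ.mem_support_none hm
    | some t => simp [ho] at h'

lemma Scheduler.state_path (n : ℕ) :
    (σ.path s ω).state n = (σ.hist s ω n).map fun x => x (Fin.last n) := rfl

lemma Scheduler.path_mem_cyl_iff {n : ℕ} (x : Fin (n + 1) → S) :
    σ.path s ω ∈ cyl L x ↔ σ.hist s ω n = some x := by
  induction n with
  | zero =>
    simp only [cyl, Set.mem_ofPred_eq, σ.state_path]
    constructor
    · intro h
      have h0 := h 0
      simp only [Scheduler.hist, Option.some.injEq]
      funext i
      have hi : i = 0 := Fin.fin_one_eq_zero i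
      subst hi
      simpa [Scheduler.hist] using h0
    · intro h i
      have hi : i = 0 := Fin.fin_one_eq_zero i
      subst hi
      have h' := congrArg (Option.map fun x : Fin 1 → S => x 0) h
      simpa using h'
  | succ n ih =>
    have key : σ.path s ω ∈ cyl L x ↔
        σ.path s ω ∈ cyl L (Fin.init x) ∧
          (σ.path s ω).state (n + 1) = some (x (Fin.last (n + 1))) := by
      simp only [cyl, Set.mem_ofPred_eq]
      rw [Fin.forall_fin_succ']
      rfl
    rw [key, ih]
    constructor
    · rintro ⟨h1, h2⟩
      rw [σ.state_path, σ.hist_succ s ω h1] at h2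
      rw [σ.hist_succ s ω h1]
      cases ho : σ.fix ⟨n, Fin.init x⟩ (ω ⟨n, Fin.init x⟩) with
      | none => simp [ho] at h2
      | some t =>
        simp only [ho, Option.map_some, Fin.snoc_last, Option.some.injEq] at h2
        simp [h2, Fin.snoc_init_self]
    · intro h
      refine ⟨?_, by rw [σ.state_path, h]; rfl⟩
      cases hh : σ.hist s ω n with
      | none => simp [Scheduler.hist, hh] at h
      | some y =>
        rw [σ.hist_succ s ω hh] at h
        obtain ⟨t, -, ht⟩ := Option.map_eq_some_iff.1 h
        rw [← ht, Fin.init_snoc]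

lemma Scheduler.hist_eq_some_iff {n : ℕ} (x : Fin (n + 1) → S) :
    σ.hist s ω n = some x ↔ x 0 = s ∧ ∀ i : Fin n,
      σ.fix ⟨i, initSeg x i⟩ (ω ⟨i, initSeg x i⟩) = some (x i.succ) := by
  induction n with
  | zero =>
    simp only [Scheduler.hist, Option.some.injEq, IsEmpty.forall_iff, and_true]
    constructor
    · intro h
      rw [← h]
    · intro h
      funext i
      have hi : i = 0 := Fin.fin_one_eq_zero i
      rw [hi, h]
  | succ n ih =>
    have h1 : σ.hist s ω (n + 1) = some x ↔ σ.hist s ω n = some (Fin.init x) ∧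
        σ.fix ⟨n, Fin.init x⟩ (ω ⟨n, Fin.init x⟩) = some (x (Fin.last (n + 1))) := by
      constructor
      · intro h
        cases hh : σ.hist s ω n with
        | none => simp [Scheduler.hist, hh] at h
        | some y =>
          rw [σ.hist_succ s ω hh] at h
          obtain ⟨t, ht', ht⟩ := Option.map_eq_some_iff.1 h
          subst ht
          simp [Fin.init_snoc, ht']
      · rintro ⟨h, h'⟩
        rw [σ.hist_succ s ω h, h']
        simp [Fin.snoc_init_self]
    rw [h1, ih, Fin.forall_fin_succ', and_assoc]
    rfl

lemma measurableSet_hist_preimage (n : ℕ) :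
    letI : MeasurableSpace (Option S) := ⊤
    (Set.range fun ω => σ.hist s ω n).Countable ∧
      ∀ A : Set (Option (Fin (n + 1) → S)),
        MeasurableSet ((fun ω => σ.hist s ω n) ⁻¹' A) := by
  let _ : MeasurableSpace (Option S) := ⊤
  induction n with
  | zero =>
    simp only [Scheduler.hist]
    refine ⟨(Set.countable_singleton _).mono Set.range_const_subset, fun A => ?_⟩
    exact measurable_const (MeasurableSpace.measurableSet_top (s := A))
  | succ n ih =>
    obtain ⟨hc, hm⟩ := ih
    let g : Option (Fin (n + 1) → S) → ((Σ n : ℕ, (Fin (n + 1) → S)) → Option S) →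
        Option (Fin (n + 1 + 1) → S) := fun y ω => y.bind fun x =>
      (σ.fix ⟨n, x⟩ (ω ⟨n, x⟩)).map fun t => (Fin.snoc x t : Fin (n + 1 + 1) → S)
    have hg : ∀ ω, σ.hist s ω (n + 1) = g (σ.hist s ω n) ω := fun _ => rfl
    have hgc : ∀ y, (Set.range (g y)).Countable := by
      intro y
      cases y with
      | none => exact (Set.countable_singleton none).mono (by rintro _ ⟨ω, rfl⟩; rfl)
      | some x =>
        refine ((σ.next ⟨n, x⟩).support_countable.image
          (Option.map fun t => (Fin.snoc x t : Fin (n + 1 + 1) → S))).mono ?_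
        rintro _ ⟨ω, rfl⟩
        exact ⟨_, σ.fix_mem _ _, rfl⟩
    have hgm : ∀ y A, MeasurableSet (g y ⁻¹' A) := by
      intro y A
      cases y with
      | none => exact MeasurableSet.const (none ∈ A)
      | some x =>
        exact (measurable_pi_apply (X := fun _ : (Σ n : ℕ, (Fin (n + 1) → S)) => Option S) ⟨n, x⟩)
          (MeasurableSpace.measurableSet_top (s := {o | (σ.fix ⟨n, x⟩ o).map
            (fun t => (Fin.snoc x t : Fin (n + 1 + 1) → S)) ∈ A}))
    refine ⟨(hc.biUnion fun y _ => hgc y).mono ?_, fun A => ?_⟩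
    · rintro _ ⟨ω, rfl⟩
      exact Set.mem_biUnion (x := σ.hist s ω n) ⟨ω, rfl⟩ ⟨ω, rfl⟩
    · have : (fun ω => σ.hist s ω (n + 1)) ⁻¹' A =
          ⋃ y ∈ Set.range (fun ω => σ.hist s ω n),
            ((fun ω => σ.hist s ω n) ⁻¹' {y}) ∩ g y ⁻¹' A := by
        ext ω
        simp only [Set.mem_preimage, hg, Set.mem_iUnion, Set.mem_inter_iff, Set.mem_singleton_iff,
          exists_prop]
        constructor
        · intro h
          exact ⟨_, ⟨ω, rfl⟩, rfl, h⟩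
        · rintro ⟨y, -, rfl, h⟩
          exact h
      rw [this]
      exact MeasurableSet.biUnion hc fun y _ => (hm {y}).inter (hgm y A)

/-- The basic open sets form a basis. -/
lemma exists_cyl_subset {O : Set (MaxPath L)} (hO : IsOpen O) {w : MaxPath L} (hw : w ∈ O) :
    ∃ (n : ℕ) (x : Fin (n + 1) → S), w ∈ cyl L x ∧ cyl L x ⊆ O := by
  induction hO with
  | basic U hU =>
    obtain ⟨n, x, rfl⟩ := hU
    exact ⟨n, x, hw, subset_rfl⟩
  | univ =>
    obtain ⟨a, ha⟩ := Option.ne_none_iff_exists'.1 w.nonempty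
    refine ⟨0, fun _ => a, fun i => ?_, Set.subset_univ _⟩
    have hi : i = 0 := Fin.fin_one_eq_zero i
    subst hi
    exact ha
  | inter U V _ _ ihU ihV =>
    obtain ⟨n, x, hx, hxU⟩ := ihU hw.1
    obtain ⟨k, y, hy, hyV⟩ := ihV hw.2
    have aux : ∀ {n k : ℕ} (x : Fin (n + 1) → S) (y : Fin (k + 1) → S), n ≤ k →
        w ∈ cyl L x → w ∈ cyl L y → cyl L y ⊆ cyl L x := by
      intro n k x y hnk hx hy z hz i
      have h1 := hx i
      have h2 := hy ⟨i, by omega⟩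
      have h3 := hz ⟨i, by omega⟩
      simp only at h1 h2 h3
      rw [h3, ← h2, h1]
    rcases le_total n k with h | h
    · exact ⟨k, y, hy, Set.subset_inter ((aux x y h hx hy).trans hxU) hyV⟩
    · exact ⟨n, x, hx, Set.subset_inter hxU ((aux y x h hy hx).trans hyV)⟩
  | sUnion F _ ih =>
    obtain ⟨U, hU, hwU⟩ := hw
    obtain ⟨n, x, hx, hxU⟩ := ih U hU hwU
    exact ⟨n, x, hx, hxU.trans (Set.subset_sUnion_of_mem hU)⟩

lemma measurable_path :
    letI : MeasurableSpace (Option S) := ⊤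
    Measurable (σ.path s) := by
  let _ : MeasurableSpace (Option S) := ⊤
  refine measurable_of_isOpen fun O hO => ?_
  have : σ.path s ⁻¹' O =
      ⋃ n, (fun ω => σ.hist s ω n) ⁻¹' {y | ∃ x, y = some x ∧ cyl L x ⊆ O} := by
    ext ω
    simp only [Set.mem_preimage, Set.mem_iUnion, Set.mem_ofPred_eq]
    constructor
    · intro h
      obtain ⟨n, x, hx, hxO⟩ := exists_cyl_subset hO h
      exact ⟨n, x, (σ.path_mem_cyl_iff s ω x).1 hx, hxO⟩
    · rintro ⟨n, x, hx, hxO⟩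
      exact hxO ((σ.path_mem_cyl_iff s ω x).2 hx)
  rw [this]
  exact MeasurableSet.iUnion fun n => (measurableSet_hist_preimage σ s n).2 _

theorem exists_isPathMeasure : ∃ m : Measure (MaxPath L), IsPathMeasure σ s m := by
  let _ : MeasurableSpace (Option S) := ⊤
  let μ : (Σ n : ℕ, (Fin (n + 1) → S)) → Measure (Option S) := fun p => (σ.next p).toMeasure
  have hmeas := measurable_path σ s
  refine ⟨(Measure.infinitePi μ).map (σ.path s),
    Measure.isProbabilityMeasure_map hmeas.aemeasurable, fun n x => ?_⟩
  have hcyl : MeasurableSet (cyl L x) :=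
    (TopologicalSpace.isOpen_generateFrom_of_mem ⟨n, x, rfl⟩ : IsOpen (cyl L x)).measurableSet
  rw [Measure.map_apply hmeas hcyl]
  constructor
  · intro hx
    classical
    let e : Fin n → (Σ n : ℕ, (Fin (n + 1) → S)) := fun i => ⟨i, initSeg x i⟩
    have he : Function.Injective e := fun i j hij => Fin.ext (congrArg Sigma.fst hij)
    let T : (Σ n : ℕ, (Fin (n + 1) → S)) → Set (Option S) := fun p =>
      if h : p.1 < n then {o | σ.fix p o = some (x (Fin.succ ⟨p.1, h⟩))} else Set.univ
    have hpre : σ.path s ⁻¹' cyl L x = Set.pi (Finset.univ.image e : Finset _) T := by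
      ext ω
      rw [Set.mem_preimage, σ.path_mem_cyl_iff, σ.hist_eq_some_iff]
      simp [hx, T, e, Set.mem_pi]
      rfl
    rw [hpre, Measure.infinitePi_pi μ (fun _ _ => MeasurableSpace.measurableSet_top),
      Finset.prod_image (fun i _ j _ h => he h)]
    refine Finset.prod_congr rfl fun i _ => ?_
    rw [← σ.next_some]
    have hT : T (e i) = {o | σ.fix (e i) o = some (x i.succ)} := by
      simp [T, e]
      rfl
    rw [hT, ← PMF.toMeasure_apply_singleton (σ.next ⟨i, initSeg x i⟩) _
      MeasurableSpace.measurableSet_top]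
    refine PMF.toMeasure_apply_eq_of_inter_support_eq _ MeasurableSpace.measurableSet_top
      MeasurableSpace.measurableSet_top ?_
    ext o
    simp only [Set.mem_inter_iff, Set.mem_ofPred_eq, Set.mem_singleton_iff]
    constructor
    · rintro ⟨h1, h2⟩
      rw [σ.fix_of_mem h2] at h1
      exact ⟨h1, h2⟩
    · rintro ⟨h1, h2⟩
      exact ⟨by rw [← h1]; exact σ.fix_of_mem (h1 ▸ h2), h2⟩
  · intro hx
    have : σ.path s ⁻¹' cyl L x = ∅ := by
      ext ω
      rw [Set.mem_preimage, σ.path_mem_cyl_iff, σ.hist_eq_some_iff]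
      simp [hx]
    rw [this, measure_empty]

end Existence

/-- The probability measure on maximal paths induced by the Markov run `(s, σ)`. -/
def Scheduler.measure {S : Type u} {L : PNTS S} (σ : Scheduler L) (s : S) :
    Measure (MaxPath L) :=
  Classical.choose (exists_isPathMeasure σ s)

theorem Scheduler.isPathMeasure_measure {S : Type u} {L : PNTS S} (σ : Scheduler L) (s : S) :
    IsPathMeasure σ s (σ.measure s) :=
  Classical.choose_spec (exists_isPathMeasure σ s)

/-! ## The logic PCTL -/

/-- The two threshold comparisons `>` and `≥`. -/
inductive Cmp
  | gt
  | ge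

/-- `a ⋊ b`. -/
def Cmp.Holds : Cmp → ℝ≥0∞ → ℝ≥0∞ → Prop
  | .gt, a, b => a > b
  | .ge, a, b => a ≥ b

mutual

/-- PCTL state-formulas over the propositional symbols `AP`. -/
inductive StateFormula (AP : Type v) : Type v
  | tru : StateFormula AP
  | prop : AP → StateFormula AP
  | neg : StateFormula AP → StateFormula AP
  | or : StateFormula AP → StateFormula AP → StateFormula AP
  | ex : PathFormula AP → StateFormula AP
  | all : PathFormula AP → StateFormula AP
  | probEx : Cmp → Set.Icc (0 : ℚ) 1 → PathFormula AP → StateFormula AP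
  | probAll : Cmp → Set.Icc (0 : ℚ) 1 → PathFormula AP → StateFormula AP

/-- PCTL path-formulas: next and until. -/
inductive PathFormula (AP : Type v) : Type v
  | next : StateFormula AP → PathFormula AP
  | until : StateFormula AP → StateFormula AP → PathFormula AP

end

section PCTLSemantics

variable {AP : Type v} {S : Type u} (L : PNTS S) (ρ : AP → Set S)

mutual

/-- The set of states satisfying a state-formula. -/
def StateFormula.sat : StateFormula AP → Set S
  | .tru => Set.univ
  | .prop P => ρ P
  | .neg φ => (StateFormula.sat φ)ᶜ
  | .or φ₁ φ₂ => StateFormula.sat φ₁ ∪ StateFormula.sat φ₂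
  | .ex ψ => {s | ∃ w : MaxPath L, w.state 0 = some s ∧ w ∈ PathFormula.sat ψ}
  | .all ψ => {s | ∀ w : MaxPath L, w.state 0 = some s → w ∈ PathFormula.sat ψ}
  | .probEx c q ψ => {s | c.Holds (⨆ σ : Scheduler L, σ.measure s (PathFormula.sat ψ))
      (ENNReal.ofReal ((q : ℚ) : ℝ))}
  | .probAll c q ψ => {s | c.Holds (⨅ σ : Scheduler L, σ.measure s (PathFormula.sat ψ))
      (ENNReal.ofReal ((q : ℚ) : ℝ))}

/-- The set of maximal paths satisfying a path-formula. -/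
def PathFormula.sat : PathFormula AP → Set (MaxPath L)
  | .next φ => {w | ∃ t, w.state 1 = some t ∧ t ∈ StateFormula.sat φ}
  | .until φ₁ φ₂ => {w | ∃ n, (∃ t, w.state n = some t ∧ t ∈ StateFormula.sat φ₂) ∧
      ∀ m < n, ∃ t, w.state m = some t ∧ t ∈ StateFormula.sat φ₁}

end

end PCTLSemantics

/-! ## The Łukasiewicz modal μ-calculus -/

/-- Formulas of the Łukasiewicz modal μ-calculus; the variables are the natural numbers, `nprop P`
is the complement of the propositional letter `P`, and scalars are rationals in `[0, 1]`. -/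
inductive Formula (AP : Type v) : Type v
  | var : ℕ → Formula AP
  | prop : AP → Formula AP
  | nprop : AP → Formula AP
  | smul : Set.Icc (0 : ℚ) 1 → Formula AP → Formula AP
  | sup : Formula AP → Formula AP → Formula AP
  | inf : Formula AP → Formula AP → Formula AP
  | oplus : Formula AP → Formula AP → Formula AP
  | odot : Formula AP → Formula AP → Formula AP
  | dia : Formula AP → Formula AP
  | box : Formula AP → Formula AP
  | mu : ℕ → Formula AP → Formula AP
  | nu : ℕ → Formula AP → Formula AP

/-- Łukasiewicz strong disjunction `min (1, a + b)`. -/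
def lukOplus (a b : unitInterval) : unitInterval :=
  ⟨min 1 ((a : ℝ) + b), le_min zero_le_one (add_nonneg a.2.1 b.2.1), min_le_left _ _⟩

/-- Łukasiewicz strong conjunction `max (0, a + b - 1)`. -/
def lukOdot (a b : unitInterval) : unitInterval :=
  ⟨max 0 ((a : ℝ) + b - 1), le_max_left _ _,
    max_le zero_le_one (by have := a.2.2; have := b.2.2; linarith)⟩

/-- A rational scalar in `[0, 1]` as an element of the real unit interval. -/
def scalar (q : Set.Icc (0 : ℚ) 1) : unitInterval :=
  ⟨((q : ℚ) : ℝ), by exact_mod_cast q.2.1, by exact_mod_cast q.2.2⟩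

lemma summable_avg {S : Type u} (d : PMF S) (f : S → unitInterval) :
    Summable fun y => (d y).toReal * (f y : ℝ) :=
  Summable.of_nonneg_of_le (fun y => mul_nonneg ENNReal.toReal_nonneg (f y).2.1)
    (fun y => mul_le_of_le_one_right ENNReal.toReal_nonneg (f y).2.2)
    (ENNReal.summable_toReal d.tsum_coe_ne_top)

/-- The average `∑ y, d y * f y`. -/
def avg {S : Type u} (d : PMF S) (f : S → unitInterval) : unitInterval :=
  ⟨∑' y, (d y).toReal * (f y : ℝ),
    tsum_nonneg fun y => mul_nonneg ENNReal.toReal_nonneg (f y).2.1, by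
    have h1 : ∑' y, (d y).toReal = 1 := by
      rw [← ENNReal.tsum_toReal_eq d.apply_ne_top, d.tsum_coe, ENNReal.toReal_one]
    rw [← h1]
    exact (summable_avg d f).tsum_le_tsum
      (fun y => mul_le_of_le_one_right ENNReal.toReal_nonneg (f y).2.2)
      (ENNReal.summable_toReal d.tsum_coe_ne_top)⟩

lemma avg_mono {S : Type u} (d : PMF S) {f g : S → unitInterval} (h : f ≤ g) : avg d f ≤ avg d g :=
  Subtype.mk_le_mk.2 <| (summable_avg d f).tsum_le_tsum
    (fun y => mul_le_mul_of_nonneg_left (h y) ENNReal.toReal_nonneg) (summable_avg d g)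

/-- The semantics of a formula, for an interpretation `π` of the propositional letters, as a
monotone function of the interpretation of the variables. -/
def Formula.sem {AP : Type v} {S : Type u} (L : PNTS S) (π : AP → S → unitInterval) :
    Formula AP → ((ℕ → S → unitInterval) →o (S → unitInterval))
  | .var X => ⟨fun ρ => ρ X, fun _ _ h => h X⟩
  | .prop P => ⟨fun _ => π P, fun _ _ _ => le_rfl⟩
  | .nprop P => ⟨fun _ x => unitInterval.symm (π P x), fun _ _ _ => le_rfl⟩
  | .smul q φ => ⟨fun ρ x => scalar q * Formula.sem L π φ ρ x,
      fun _ _ h x => mul_le_mul_right ((Formula.sem L π φ).monotone h x) _⟩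
  | .sup φ ψ => ⟨fun ρ x => max (Formula.sem L π φ ρ x) (Formula.sem L π ψ ρ x),
      fun _ _ h x => max_le_max ((Formula.sem L π φ).monotone h x)
        ((Formula.sem L π ψ).monotone h x)⟩
  | .inf φ ψ => ⟨fun ρ x => min (Formula.sem L π φ ρ x) (Formula.sem L π ψ ρ x),
      fun _ _ h x => min_le_min ((Formula.sem L π φ).monotone h x)
        ((Formula.sem L π ψ).monotone h x)⟩
  | .oplus φ ψ => ⟨fun ρ x => lukOplus (Formula.sem L π φ ρ x) (Formula.sem L π ψ ρ x),
      fun _ _ h x => Subtype.mk_le_mk.2 <| min_le_min le_rfl <|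
        add_le_add (Subtype.coe_le_coe.2 ((Formula.sem L π φ).monotone h x))
          (Subtype.coe_le_coe.2 ((Formula.sem L π ψ).monotone h x))⟩
  | .odot φ ψ => ⟨fun ρ x => lukOdot (Formula.sem L π φ ρ x) (Formula.sem L π ψ ρ x),
      fun _ _ h x => Subtype.mk_le_mk.2 <| max_le_max le_rfl <| sub_le_sub_right
        (add_le_add (Subtype.coe_le_coe.2 ((Formula.sem L π φ).monotone h x))
          (Subtype.coe_le_coe.2 ((Formula.sem L π ψ).monotone h x))) _⟩
  | .dia φ => ⟨fun ρ x => ⨆ (d : PMF S) (_ : L.trans x d), avg d (Formula.sem L π φ ρ),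
      fun _ _ h _ => iSup₂_mono fun d _ => avg_mono d ((Formula.sem L π φ).monotone h)⟩
  | .box φ => ⟨fun ρ x => ⨅ (d : PMF S) (_ : L.trans x d), avg d (Formula.sem L π φ ρ),
      fun _ _ h _ => iInf₂_mono fun d _ => avg_mono d ((Formula.sem L π φ).monotone h)⟩
  | .mu X φ => ⟨fun ρ => OrderHom.lfp ⟨fun f => Formula.sem L π φ (Function.update ρ X f),
        fun _ _ h => (Formula.sem L π φ).monotone (update_le_update_iff.2
          ⟨h, fun _ _ => le_rfl⟩)⟩,
      fun _ _ h => OrderHom.lfp.monotone fun _ => (Formula.sem L π φ).monotone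
        (update_le_update_iff.2 ⟨le_rfl, fun Y _ => h Y⟩)⟩
  | .nu X φ => ⟨fun ρ => OrderHom.gfp ⟨fun f => Formula.sem L π φ (Function.update ρ X f),
        fun _ _ h => (Formula.sem L π φ).monotone (update_le_update_iff.2
          ⟨h, fun _ _ => le_rfl⟩)⟩,
      fun _ _ h => OrderHom.gfp.monotone fun _ => (Formula.sem L π φ).monotone
        (update_le_update_iff.2 ⟨le_rfl, fun Y _ => h Y⟩)⟩

namespace Formula

variable {AP : Type v}

/-- The constant `1`, as the formula `ν X. X`. -/
def one : Formula AP := .nu 0 (.var 0)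

/-- The constant `q`, as the formula `q 1`. -/
def const (q : Set.Icc (0 : ℚ) 1) : Formula AP := .smul q one

/-- `1 - q`. -/
def compl (q : Set.Icc (0 : ℚ) 1) : Set.Icc (0 : ℚ) 1 :=
  ⟨1 - q, sub_nonneg.2 q.2.2, sub_le_self _ q.2.1⟩

/-- Dualization; it expresses negation on closed formulas. -/
def negate : Formula AP → Formula AP
  | .var X => .var X
  | .prop P => .nprop P
  | .nprop P => .prop P
  | .smul q φ => .oplus (.smul q (negate φ)) (const (compl q))
  | .sup φ ψ => .inf (negate φ) (negate ψ)
  | .inf φ ψ => .sup (negate φ) (negate ψ)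
  | .oplus φ ψ => .odot (negate φ) (negate ψ)
  | .odot φ ψ => .oplus (negate φ) (negate ψ)
  | .dia φ => .box (negate φ)
  | .box φ => .dia (negate φ)
  | .mu X φ => .nu X (negate φ)
  | .nu X φ => .mu X (negate φ)

/-- A variable greater than every variable (free or bound) that appears in the formula. -/
def fresh : Formula AP → ℕ
  | .var X => X + 1
  | .prop _ => 0
  | .nprop _ => 0
  | .smul _ φ => fresh φ
  | .sup φ ψ => max (fresh φ) (fresh ψ)
  | .inf φ ψ => max (fresh φ) (fresh ψ)
  | .oplus φ ψ => max (fresh φ) (fresh ψ)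
  | .odot φ ψ => max (fresh φ) (fresh ψ)
  | .dia φ => fresh φ
  | .box φ => fresh φ
  | .mu X φ => max (X + 1) (fresh φ)
  | .nu X φ => max (X + 1) (fresh φ)

/-- The threshold modality `P_{>0} φ = μ Y. (Y ⊕ φ)`. -/
def posThr (φ : Formula AP) : Formula AP := .mu (fresh φ) (.oplus (.var (fresh φ)) φ)

/-- The threshold modality `P_{=1} φ = ν Y. (Y ⊙ φ)`. -/
def oneThr (φ : Formula AP) : Formula AP := .nu (fresh φ) (.odot (.var (fresh φ)) φ)

/-- The threshold modalities `P_{>q}` and `P_{≥q}` for `q ∈ [0, 1]`, where `P_{≥1}` is `P_{=1}`. -/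
def thr (c : Cmp) (q : Set.Icc (0 : ℚ) 1) (φ : Formula AP) : Formula AP :=
  match c with
  | .gt => if (q : ℚ) = 0 then posThr φ else posThr (.odot φ (const (compl q)))
  | .ge => if (q : ℚ) = 1 then oneThr φ else oneThr (.oplus φ (const (compl q)))

/-- The modality `⊡ φ = □ φ ⊓ ◇ 1`. -/
def boxdot (φ : Formula AP) : Formula AP := .inf (.box φ) (.dia one)

end Formula

open Formula in
/-- The encoding of PCTL state-formulas as closed formulas of the Łukasiewicz modal μ-calculus. -/
def StateFormula.encode {AP : Type v} : StateFormula AP → Formula AP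
  | .tru => one
  | .prop P => .prop P
  | .neg φ => negate φ.encode
  | .or φ₁ φ₂ => .sup φ₁.encode φ₂.encode
  | .ex (.next φ) => posThr (.dia φ.encode)
  | .all (.next φ) => oneThr (boxdot φ.encode)
  | .ex (.until φ₁ φ₂) =>
      .mu 0 (.sup φ₂.encode (.inf φ₁.encode (posThr (.dia (.var 0)))))
  | .all (.until φ₁ φ₂) =>
      .mu 0 (.sup φ₂.encode (.inf φ₁.encode (oneThr (boxdot (.var 0)))))
  | .probEx c q (.next φ) => thr c q (.dia φ.encode)
  | .probAll c q (.next φ) => thr c q (boxdot φ.encode)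
  | .probEx c q (.until φ₁ φ₂) =>
      thr c q (.mu 0 (.sup φ₂.encode (.inf φ₁.encode (.dia (.var 0)))))
  | .probAll c q (.until φ₁ φ₂) =>
      thr c q (.mu 0 (.sup φ₂.encode (.inf φ₁.encode (boxdot (.var 0)))))

/-- The `{0, 1}`-valued characteristic function of a set. -/
def char {S : Type u} (A : Set S) : S → unitInterval := A.indicator (fun _ => 1)

end

end LukPCTL

/-!
Every PCTL formula is encoded by a formula that denotes a `{0, 1}`-valued function, so the proof is
an induction on the PCTL formula (`sem_encode`), with one argument for each operator.

*Negation.* `negate φ` denotes `1 - φ` if the free variables are complemented as well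
(`sem_negate`). The value of an encoding does not depend on the variables, by the induction
hypothesis, so nothing is lost by complementing them.

*Threshold modalities.* `P_{>0}` and `P_{=1}` are the tests for being nonzero and for being `1`
(`sem_posThr`, `sem_oneThr`), and all comparisons with a rational reduce to these (`sem_thr`).

*Qualitative until.* Under a threshold modality, `◇` and `⊡` see only the graph of the system, and
the least fixed points become least sets closed under a rule for `∃` and a rule for `∀`. For `∀`,
from a state outside of a closed set there is a maximal path that avoids the set as long as it can,
and this path does not satisfy the until formula (`mem_of_forall_untilSet`). No transfinite
iteration is needed, although the branching may be infinite.

*Quantitative until.* For a fixed scheduler, the probability of an until event is the limit of the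
probabilities `Scheduler.untilProb` of reaching the target within `k` steps, which satisfy a
recursion on histories (`Scheduler.measure_untilSet`). The set of states may be uncountable, but
each history has only countably many continuations of positive probability, and these carry its
whole mass (`Scheduler.measure_cyl_inter`). Comparison with the least fixed points then takes four
inequalities:
* the supremum over all schedulers is closed under the `◇`-step, by stitching nearly optimal
  schedulers together (`Scheduler.tsum_mul_iSup_measure_untilSet_le`);
* it is below every function closed under the `◇`-step (`Scheduler.measure_untilSet_le`);
* the infimum over all schedulers is closed under the `⊡`-step, as the remainder of a scheduler is
  a scheduler (`Scheduler.measure_untilSet_ge_tsum`);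
* it is below every function closed under the `⊡`-step, by a scheduler whose choices are optimal up
  to errors with a small sum (`Scheduler.iInf_measure_untilSet_le`).
-/

namespace LukPCTL

section Semantics

universe u v

variable {AP : Type v} {S : Type u} {L : PNTS S} {π : AP → S → unitInterval}

namespace Formula

/-! ### Unfolding the semantics -/

section Unfold

variable (ρ : ℕ → S → unitInterval) (φ ψ : Formula AP) (x : S)

lemma sem_var (X : ℕ) : sem L π (.var X) ρ = ρ X := rfl

lemma sem_prop (P : AP) : sem L π (.prop P) ρ = π P := rfl

lemma sem_smul (q : Set.Icc (0 : ℚ) 1) : sem L π (.smul q φ) ρ x = scalar q * sem L π φ ρ x := rfl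

lemma sem_sup : sem L π (.sup φ ψ) ρ x = max (sem L π φ ρ x) (sem L π ψ ρ x) := rfl

lemma sem_inf : sem L π (.inf φ ψ) ρ x = min (sem L π φ ρ x) (sem L π ψ ρ x) := rfl

lemma sem_oplus :
    sem L π (.oplus φ ψ) ρ x = lukOplus (sem L π φ ρ x) (sem L π ψ ρ x) := rfl

lemma sem_odot :
    sem L π (.odot φ ψ) ρ x = lukOdot (sem L π φ ρ x) (sem L π ψ ρ x) := rfl

lemma sem_dia :
    sem L π (.dia φ) ρ x = ⨆ (d : PMF S) (_ : L.trans x d), avg d (sem L π φ ρ) := rfl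

lemma sem_box :
    sem L π (.box φ) ρ x = ⨅ (d : PMF S) (_ : L.trans x d), avg d (sem L π φ ρ) := rfl

end Unfold

lemma sem_mu_le {X : ℕ} {φ : Formula AP} {ρ : ℕ → S → unitInterval} {f : S → unitInterval}
    (h : sem L π φ (Function.update ρ X f) ≤ f) : sem L π (.mu X φ) ρ ≤ f :=
  OrderHom.lfp_le _ h

lemma sem_mu_eq (X : ℕ) (φ : Formula AP) (ρ : ℕ → S → unitInterval) :
    sem L π φ (Function.update ρ X (sem L π (.mu X φ) ρ)) = sem L π (.mu X φ) ρ :=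
  OrderHom.map_lfp ⟨fun f => sem L π φ (Function.update ρ X f), _⟩

lemma le_sem_nu {X : ℕ} {φ : Formula AP} {ρ : ℕ → S → unitInterval} {f : S → unitInterval}
    (h : f ≤ sem L π φ (Function.update ρ X f)) : f ≤ sem L π (.nu X φ) ρ :=
  OrderHom.le_gfp _ h

lemma sem_nu_eq (X : ℕ) (φ : Formula AP) (ρ : ℕ → S → unitInterval) :
    sem L π φ (Function.update ρ X (sem L π (.nu X φ) ρ)) = sem L π (.nu X φ) ρ :=
  OrderHom.map_gfp ⟨fun f => sem L π φ (Function.update ρ X f), _⟩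

/-- The semantics does not depend on variables that do not appear; in particular the fixed-point
variables of the threshold modalities are not captured. -/
lemma sem_update_of_fresh_le (φ : Formula AP) {X : ℕ} (hX : fresh φ ≤ X)
    (ρ : ℕ → S → unitInterval) (f : S → unitInterval) :
    sem L π φ (Function.update ρ X f) = sem L π φ ρ := by
  induction φ generalizing ρ with
  | var Y =>
    have : Y ≠ X := by simp only [fresh] at hX; omega
    exact Function.update_of_ne this _ _
  | prop P => rfl
  | nprop P => rfl
  | smul q φ ih => funext x; rw [sem_smul, sem_smul, ih hX]
  | sup φ ψ ih ih' =>
    simp only [fresh, max_le_iff] at hX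
    funext x
    simp only [sem_sup, ih hX.1, ih' hX.2]
  | inf φ ψ ih ih' =>
    simp only [fresh, max_le_iff] at hX
    funext x
    simp only [sem_inf, ih hX.1, ih' hX.2]
  | oplus φ ψ ih ih' =>
    simp only [fresh, max_le_iff] at hX
    funext x
    simp only [sem_oplus, ih hX.1, ih' hX.2]
  | odot φ ψ ih ih' =>
    simp only [fresh, max_le_iff] at hX
    funext x
    simp only [sem_odot, ih hX.1, ih' hX.2]
  | dia φ ih =>
    simp only [fresh] at hX
    funext x
    simp only [sem_dia, ih hX]
  | box φ ih =>
    simp only [fresh] at hX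
    funext x
    simp only [sem_box, ih hX]
  | mu Y φ ih =>
    simp only [fresh, max_le_iff] at hX
    have hne : X ≠ Y := by omega
    change OrderHom.lfp _ = OrderHom.lfp _
    simp only [Function.update_comm hne, ih hX.2]
  | nu Y φ ih =>
    simp only [fresh, max_le_iff] at hX
    have hne : X ≠ Y := by omega
    change OrderHom.gfp _ = OrderHom.gfp _
    simp only [Function.update_comm hne, ih hX.2]

lemma sem_one (ρ : ℕ → S → unitInterval) : sem L π one ρ = fun _ => 1 :=
  le_antisymm (fun _ => unitInterval.le_one') (le_sem_nu (by simp [sem_var]))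

lemma sem_const (q : Set.Icc (0 : ℚ) 1) (ρ : ℕ → S → unitInterval) :
    sem L π (const q) ρ = fun _ => scalar q := by
  funext x
  simp [const, sem_smul, sem_one]

/-! ### Threshold modalities -/

open Classical in
/-- `P_{>0}` is the two-valued test for being nonzero: a fixed point `y` of `y ↦ y ⊕ a` with `a > 0`
is `1`, and `0` is a fixed point if `a = 0`. -/
lemma sem_posThr (φ : Formula AP) (ρ : ℕ → S → unitInterval) (x : S) :
    sem L π (posThr φ) ρ x = if sem L π φ ρ x = 0 then 0 else 1 := by
  have body : ∀ (f : S → unitInterval) (y : S),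
      sem L π (.oplus (.var (fresh φ)) φ) (Function.update ρ (fresh φ) f) y =
        lukOplus (f y) (sem L π φ ρ y) := by
    intro f y
    simp [sem_oplus, sem_var, sem_update_of_fresh_le φ le_rfl]
  have hle : sem L π (posThr φ) ρ ≤ fun y => if sem L π φ ρ y = 0 then 0 else 1 := by
    refine sem_mu_le fun y => ?_
    rw [body]
    dsimp only
    split_ifs with h
    · rw [h]
      simp [lukOplus]
    · exact unitInterval.le_one'
  split_ifs with h
  · simpa [h] using hle x
  · have hfix := congrFun (sem_mu_eq (L := L) (π := π) (fresh φ) (.oplus (.var (fresh φ)) φ) ρ) x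
    rw [body] at hfix
    have hpos : (0 : ℝ) < sem L π φ ρ x := unitInterval.coe_pos.2 (unitInterval.pos_iff_ne_zero.2 h)
    have h' := congrArg Subtype.val hfix
    change min 1 _ = _ at h'
    refine Subtype.ext ?_
    change ((sem L π (.mu (fresh φ) (.oplus (.var (fresh φ)) φ)) ρ x : unitInterval) : ℝ) = 1
    rcases min_choice (1 : ℝ) ((sem L π (.mu (fresh φ) (.oplus (.var (fresh φ)) φ)) ρ x : ℝ) +
      (sem L π φ ρ x : ℝ)) with h1 | h1 <;> rw [h1] at h' <;> linarith

open Classical in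
/-- `P_{=1}` is the two-valued test for being `1`: a fixed point `y` of `y ↦ y ⊙ a` with `a < 1` is
`0`, and `1` is a fixed point if `a = 1`. -/
lemma sem_oneThr (φ : Formula AP) (ρ : ℕ → S → unitInterval) (x : S) :
    sem L π (oneThr φ) ρ x = if sem L π φ ρ x = 1 then 1 else 0 := by
  have body : ∀ (f : S → unitInterval) (y : S),
      sem L π (.odot (.var (fresh φ)) φ) (Function.update ρ (fresh φ) f) y =
        lukOdot (f y) (sem L π φ ρ y) := by
    intro f y
    simp [sem_odot, sem_var, sem_update_of_fresh_le φ le_rfl]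
  have hle : (fun y => if sem L π φ ρ y = 1 then 1 else 0) ≤ sem L π (oneThr φ) ρ := by
    refine le_sem_nu fun y => ?_
    rw [body]
    dsimp only
    split_ifs with h
    · rw [h]
      simp [lukOdot]
    · exact unitInterval.nonneg'
  split_ifs with h
  · exact le_antisymm unitInterval.le_one' (by simpa [h] using hle x)
  · have hfix := congrFun (sem_nu_eq (L := L) (π := π) (fresh φ) (.odot (.var (fresh φ)) φ) ρ) x
    rw [body] at hfix
    have hlt : (sem L π φ ρ x : ℝ) < 1 :=
      unitInterval.coe_lt_one.2 (unitInterval.lt_one_iff_ne_one.2 h)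
    have h' := congrArg Subtype.val hfix
    change max 0 _ = _ at h'
    refine Subtype.ext ?_
    change ((sem L π (.nu (fresh φ) (.odot (.var (fresh φ)) φ)) ρ x : unitInterval) : ℝ) = 0
    rcases max_choice (0 : ℝ) ((sem L π (.nu (fresh φ) (.odot (.var (fresh φ)) φ)) ρ x : ℝ) +
      (sem L π φ ρ x : ℝ) - 1) with h1 | h1 <;> rw [h1] at h' <;> linarith

open Classical in
/-- The shifts by `1 - q` turn a comparison with `q` into one with `0` or `1`: `a ⊙ (1 - q)` is
`max 0 (a - q)`, and `a ⊕ (1 - q)` is `1` iff `q ≤ a`. -/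
lemma sem_thr (c : Cmp) (q : Set.Icc (0 : ℚ) 1) (φ : Formula AP) (ρ : ℕ → S → unitInterval)
    (x : S) :
    sem L π (thr c q φ) ρ x =
      if c.Holds (ENNReal.ofReal (sem L π φ ρ x)) (ENNReal.ofReal ((q : ℚ) : ℝ)) then 1 else 0 := by
  have hq0 : (0 : ℝ) ≤ ((q : ℚ) : ℝ) := by exact_mod_cast q.2.1
  have ha := (sem L π φ ρ x).2
  have hc : ((scalar (compl q) : unitInterval) : ℝ) = 1 - ((q : ℚ) : ℝ) := by
    simp [scalar, compl]
  cases c with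
  | gt =>
    have hh : Cmp.gt.Holds (ENNReal.ofReal (sem L π φ ρ x)) (ENNReal.ofReal ((q : ℚ) : ℝ)) ↔
        ((q : ℚ) : ℝ) < sem L π φ ρ x := ENNReal.ofReal_lt_ofReal_iff_of_nonneg hq0
    rw [if_congr hh rfl rfl]
    unfold thr
    dsimp only
    split_ifs with hq h h
    · rw [sem_posThr, if_neg]
      rintro h0
      simp [h0, hq] at h
    · rw [sem_posThr, if_pos]
      refine Subtype.ext (le_antisymm ?_ ha.1)
      simp only [hq, Rat.cast_zero, not_lt] at h
      exact h
    · rw [sem_posThr, if_neg]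
      intro h0
      have h1 := congrArg Subtype.val h0
      simp only [sem_odot, sem_const, lukOdot, hc] at h1
      have := (le_max_right _ _).trans h1.le
      simp at this
      linarith
    · rw [sem_posThr, if_pos]
      refine Subtype.ext ?_
      simp only [sem_odot, sem_const, lukOdot, hc]
      exact max_eq_left (by linarith)
  | ge =>
    have hh : Cmp.ge.Holds (ENNReal.ofReal (sem L π φ ρ x)) (ENNReal.ofReal ((q : ℚ) : ℝ)) ↔
        ((q : ℚ) : ℝ) ≤ sem L π φ ρ x := ENNReal.ofReal_le_ofReal_iff ha.1
    rw [if_congr hh rfl rfl]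
    unfold thr
    dsimp only
    split_ifs with hq h h
    · rw [sem_oneThr, if_pos]
      refine Subtype.ext (le_antisymm ha.2 ?_)
      simp only [hq, Rat.cast_one] at h
      exact h
    · rw [sem_oneThr, if_neg]
      rintro h0
      simp [h0, hq] at h
    · rw [sem_oneThr, if_pos]
      refine Subtype.ext ?_
      simp only [sem_oplus, sem_const, lukOplus, hc]
      exact min_eq_left (by linarith)
    · rw [sem_oneThr, if_neg]
      intro h0
      have h1 := congrArg Subtype.val h0
      simp only [sem_oplus, sem_const, lukOplus, hc] at h1
      have := h1.ge.trans (min_le_right _ _)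
      simp at this
      linarith

end Formula

/-! ### Duality -/

lemma avg_symm (d : PMF S) (f : S → unitInterval) :
    avg d (fun y => unitInterval.symm (f y)) = unitInterval.symm (avg d f) := by
  have h1 : ∑' y, (d y).toReal = 1 := by
    rw [← ENNReal.tsum_toReal_eq d.apply_ne_top, d.tsum_coe, ENNReal.toReal_one]
  refine Subtype.ext ?_
  change ∑' y, (d y).toReal * (1 - (f y : ℝ)) = 1 - ∑' y, (d y).toReal * (f y : ℝ)
  nth_rewrite 2 [← h1]
  rw [← (ENNReal.summable_toReal d.tsum_coe_ne_top).tsum_sub (summable_avg d f)]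
  exact tsum_congr fun y => by ring

lemma symm_iSup {ι : Sort*} (f : ι → unitInterval) :
    unitInterval.symm (⨆ i, f i) = ⨅ i, unitInterval.symm (f i) :=
  eq_of_forall_le_iff fun c => by
    simp only [unitInterval.le_symm_comm, iSup_le_iff, le_iInf_iff]

lemma symm_iInf {ι : Sort*} (f : ι → unitInterval) :
    unitInterval.symm (⨅ i, f i) = ⨆ i, unitInterval.symm (f i) :=
  eq_of_forall_ge_iff fun c => by
    simp only [unitInterval.symm_le_comm, iSup_le_iff, le_iInf_iff]

namespace Formula

/-- The dualized formula denotes the complement when the free variables are complemented too. -/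
lemma sem_negate (φ : Formula AP) (ρ : ℕ → S → unitInterval) :
    sem L π (negate φ) (fun X x => unitInterval.symm (ρ X x)) =
      fun x => unitInterval.symm (sem L π φ ρ x) := by
  have hupd : ∀ (ρ : ℕ → S → unitInterval) (X : ℕ) (f : S → unitInterval),
      (fun Y x => unitInterval.symm (Function.update ρ X f Y x)) =
        Function.update (fun Y x => unitInterval.symm (ρ Y x)) X
          (fun x => unitInterval.symm (f x)) := by
    intro ρ X f
    funext Y
    by_cases h : Y = X
    · subst h; simp
    · simp [h]
  induction φ generalizing ρ with
  | var Y => rfl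
  | prop P => rfl
  | nprop P => funext x; exact (unitInterval.symm_symm _).symm
  | smul q φ ih =>
    funext x
    refine Subtype.ext ?_
    simp only [negate, sem_oplus, sem_smul, ih, sem_const, lukOplus]
    simp only [scalar, compl, unitInterval.coe_symm_eq, Set.Icc.coe_mul, Rat.cast_sub, Rat.cast_one]
    rw [min_eq_right]
    · ring
    · have := mul_nonneg (show (0 : ℝ) ≤ ((q : ℚ) : ℝ) by exact_mod_cast q.2.1)
        (sem L π φ ρ x).2.1
      linarith
  | sup φ ψ ih ih' =>
    funext x
    simp only [negate, sem_sup, sem_inf, ih, ih']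
    exact unitInterval.strictAnti_symm.antitone.map_max.symm
  | inf φ ψ ih ih' =>
    funext x
    simp only [negate, sem_inf, sem_sup, ih, ih']
    exact unitInterval.strictAnti_symm.antitone.map_min.symm
  | oplus φ ψ ih ih' =>
    funext x
    refine Subtype.ext ?_
    simp only [negate, sem_oplus, sem_odot, ih, ih', lukOplus, lukOdot, unitInterval.coe_symm_eq]
    rw [← sub_self (1 : ℝ), ← max_sub_sub_left 1 (1 : ℝ)]
    congr 1
    ring
  | odot φ ψ ih ih' =>
    funext x
    refine Subtype.ext ?_
    simp only [negate, sem_odot, sem_oplus, ih, ih', lukOplus, lukOdot, unitInterval.coe_symm_eq]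
    rw [← min_sub_sub_left 1 (0 : ℝ), sub_zero]
    congr 1
    ring
  | dia φ ih =>
    funext x
    simp only [negate, sem_dia, sem_box, ih, symm_iSup, avg_symm]
  | box φ ih =>
    funext x
    simp only [negate, sem_box, sem_dia, ih, symm_iInf, avg_symm]
  | mu X φ ih =>
    refine le_antisymm (fun x => ?_) (le_sem_nu ?_)
    · have key : sem L π (.mu X φ) ρ ≤ fun x => unitInterval.symm
          (sem L π (.nu X (negate φ)) (fun X x => unitInterval.symm (ρ X x)) x) := by
        refine sem_mu_le fun y => ?_
        have h := ih (Function.update ρ X fun x => unitInterval.symm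
          (sem L π (.nu X (negate φ)) (fun X x => unitInterval.symm (ρ X x)) x))
        rw [hupd] at h
        simp only [unitInterval.symm_symm] at h
        rw [sem_nu_eq] at h
        have h' := congrArg unitInterval.symm (congrFun h y)
        rw [unitInterval.symm_symm] at h'
        exact h'.ge
      exact unitInterval.le_symm_comm.1 (key x)
    · rw [← hupd, ih, sem_mu_eq]
  | nu X φ ih =>
    refine le_antisymm (sem_mu_le ?_) (fun x => ?_)
    · rw [← hupd, ih, sem_nu_eq]
    · have key : (fun x => unitInterval.symm
          (sem L π (.mu X (negate φ)) (fun X x => unitInterval.symm (ρ X x)) x)) ≤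
            sem L π (.nu X φ) ρ := by
        refine le_sem_nu fun y => ?_
        have h := ih (Function.update ρ X fun x => unitInterval.symm
          (sem L π (.mu X (negate φ)) (fun X x => unitInterval.symm (ρ X x)) x))
        rw [hupd] at h
        simp only [unitInterval.symm_symm] at h
        rw [sem_mu_eq] at h
        have h' := congrArg unitInterval.symm (congrFun h y)
        rw [unitInterval.symm_symm] at h'
        exact h'.le
      exact unitInterval.symm_le_comm.1 (key x)

end Formula

end Semantics

/-! ### Averages and modalities -/

section Modalities

universe u v

variable {AP : Type v} {S : Type u} {L : PNTS S} {π : AP → S → unitInterval}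

lemma PNTS.exists_leadsTo_iff (s : S) : (∃ t, L.LeadsTo s t) ↔ ∃ d, L.trans s d := by
  constructor
  · rintro ⟨t, d, hd, -⟩
    exact ⟨d, hd⟩
  · rintro ⟨d, hd⟩
    obtain ⟨t, ht⟩ := d.support_nonempty
    exact ⟨t, d, hd, pos_iff_ne_zero.2 ht⟩

lemma ofReal_avg (d : PMF S) (f : S → unitInterval) :
    ENNReal.ofReal (avg d f) = ∑' y, d y * ENNReal.ofReal (f y) := by
  change ENNReal.ofReal (∑' y, (d y).toReal * (f y : ℝ)) = _
  rw [ENNReal.ofReal_tsum_of_nonneg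
    (fun y => mul_nonneg ENNReal.toReal_nonneg (f y).2.1) (summable_avg d f)]
  refine tsum_congr fun y => ?_
  rw [ENNReal.ofReal_mul ENNReal.toReal_nonneg, ENNReal.ofReal_toReal (d.apply_ne_top y)]

lemma ofReal_le_ofReal_unitInterval {a b : unitInterval} :
    ENNReal.ofReal a ≤ ENNReal.ofReal b ↔ a ≤ b :=
  ENNReal.ofReal_le_ofReal_iff b.2.1

lemma ofReal_unitInterval_injective :
    Function.Injective fun a : unitInterval => ENNReal.ofReal a :=
  fun _ _ h => le_antisymm (ofReal_le_ofReal_unitInterval.1 h.le)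
    (ofReal_le_ofReal_unitInterval.1 h.ge)

lemma exists_ofReal_eq {a : ℝ≥0∞} (h : a ≤ 1) : ∃ b : unitInterval, ENNReal.ofReal b = a :=
  ⟨⟨a.toReal, ENNReal.toReal_nonneg, by simpa using ENNReal.toReal_mono ENNReal.one_ne_top h⟩,
    ENNReal.ofReal_toReal (h.trans_lt ENNReal.one_lt_top).ne⟩

lemma tsum_mul_le_one (d : PMF S) {f : S → ℝ≥0∞} (hf : ∀ y, f y ≤ 1) : ∑' y, d y * f y ≤ 1 :=
  (ENNReal.tsum_le_tsum fun y => mul_le_of_le_one_right zero_le (hf y)).trans_eq d.tsum_coe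

lemma avg_one (d : PMF S) : avg d (fun _ => 1) = 1 :=
  ofReal_unitInterval_injective (by simp [ofReal_avg, d.tsum_coe])

lemma avg_eq_zero_iff (d : PMF S) (f : S → unitInterval) :
    avg d f = 0 ↔ ∀ t, 0 < d t → f t = 0 := by
  rw [← ofReal_unitInterval_injective.eq_iff]
  simp only [ofReal_avg, Icc.coe_zero, ENNReal.ofReal_zero, ENNReal.tsum_eq_zero, mul_eq_zero,
    ENNReal.ofReal_eq_zero, pos_iff_ne_zero]
  refine forall_congr' fun t => ?_
  have h0 : (f t : ℝ) ≤ 0 ↔ f t = 0 :=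
    ⟨fun h => Subtype.ext (le_antisymm h (f t).2.1), fun h => (congrArg Subtype.val h).le⟩
  rw [h0]
  tauto

lemma avg_eq_one_iff (d : PMF S) (f : S → unitInterval) :
    avg d f = 1 ↔ ∀ t, 0 < d t → f t = 1 := by
  have h := avg_eq_zero_iff d fun y => unitInterval.symm (f y)
  simpa only [avg_symm, unitInterval.symm_eq_zero] using h

namespace Formula

lemma ofReal_sem_dia (φ : Formula AP) (ρ : ℕ → S → unitInterval) (x : S) :
    ENNReal.ofReal (sem L π (.dia φ) ρ x) =
      ⨆ (d : PMF S) (_ : L.trans x d), ∑' y, d y * ENNReal.ofReal (sem L π φ ρ y) := by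
  refine le_antisymm ?_ (iSup₂_le fun d hd => ?_)
  · have h1 : ⨆ (d : PMF S) (_ : L.trans x d), ∑' y, d y * ENNReal.ofReal (sem L π φ ρ y) ≤ 1 :=
      iSup₂_le fun d _ => tsum_mul_le_one d fun y => by simpa using (sem L π φ ρ y).2.2
    obtain ⟨b, hb⟩ := exists_ofReal_eq h1
    rw [← hb, ofReal_le_ofReal_unitInterval, sem_dia]
    refine iSup₂_le fun d hd => ?_
    rw [← ofReal_le_ofReal_unitInterval, hb, ofReal_avg]
    exact le_iSup₂ (f := fun (d : PMF S) (_ : L.trans x d) =>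
      ∑' y, d y * ENNReal.ofReal (sem L π φ ρ y)) d hd
  · rw [← ofReal_avg, ofReal_le_ofReal_unitInterval, sem_dia]
    exact le_iSup₂ (f := fun (d : PMF S) (_ : L.trans x d) => avg d (sem L π φ ρ)) d hd

lemma sem_boxdot_of_trans (φ : Formula AP) (ρ : ℕ → S → unitInterval) {x : S}
    (h : ∃ d, L.trans x d) : sem L π (boxdot φ) ρ x = sem L π (.box φ) ρ x := by
  obtain ⟨d, hd⟩ := h
  have h1 : sem L π (.dia one) ρ x = 1 := by
    refine le_antisymm unitInterval.le_one' ?_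
    rw [← avg_one d, sem_dia, sem_one]
    exact le_iSup₂ (f := fun (d : PMF S) (_ : L.trans x d) => avg d fun _ => (1 : unitInterval))
      d hd
  rw [boxdot, sem_inf, h1]
  exact min_eq_left unitInterval.le_one'

lemma sem_boxdot_of_not_trans (φ : Formula AP) (ρ : ℕ → S → unitInterval) {x : S}
    (h : ¬ ∃ d, L.trans x d) : sem L π (boxdot φ) ρ x = 0 := by
  push Not at h
  refine le_antisymm ?_ unitInterval.nonneg'
  rw [boxdot, sem_inf, sem_dia]
  exact (min_le_right _ _).trans (iSup₂_le fun d hd => absurd hd (h d))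

/-- At a state with a transition `⊡` is the infimum of averages. A state without transitions has to
be excluded, as the empty infimum would be `∞` on the right. -/
lemma ofReal_sem_boxdot (φ : Formula AP) (ρ : ℕ → S → unitInterval) {x : S}
    (h : ∃ d, L.trans x d) :
    ENNReal.ofReal (sem L π (boxdot φ) ρ x) =
      ⨅ (d : PMF S) (_ : L.trans x d), ∑' y, d y * ENNReal.ofReal (sem L π φ ρ y) := by
  rw [sem_boxdot_of_trans φ ρ h]
  refine le_antisymm (le_iInf₂ fun d hd => ?_) ?_
  · rw [← ofReal_avg, ofReal_le_ofReal_unitInterval, sem_box]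
    exact iInf₂_le (f := fun (d : PMF S) (_ : L.trans x d) => avg d (sem L π φ ρ)) d hd
  · have h1 : ⨅ (d : PMF S) (_ : L.trans x d), ∑' y, d y * ENNReal.ofReal (sem L π φ ρ y) ≤ 1 := by
      obtain ⟨d, hd⟩ := h
      exact (iInf₂_le d hd).trans
        (tsum_mul_le_one d fun y => by simpa using (sem L π φ ρ y).2.2)
    obtain ⟨b, hb⟩ := exists_ofReal_eq h1
    rw [← hb, ofReal_le_ofReal_unitInterval, sem_box]
    refine le_iInf₂ fun d hd => ?_
    rw [← ofReal_le_ofReal_unitInterval, hb, ofReal_avg]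
    exact iInf₂_le (f := fun (d : PMF S) (_ : L.trans x d) =>
      ∑' y, d y * ENNReal.ofReal (sem L π φ ρ y)) d hd

lemma sem_dia_ne_zero_iff (φ : Formula AP) (ρ : ℕ → S → unitInterval) (x : S) :
    sem L π (.dia φ) ρ x ≠ 0 ↔ ∃ t, L.LeadsTo x t ∧ sem L π φ ρ t ≠ 0 := by
  rw [not_iff_comm]
  have hb : (0 : unitInterval) = ⊥ := rfl
  rw [sem_dia, hb, iSup₂_eq_bot, ← hb]
  simp only [avg_eq_zero_iff]
  constructor
  · intro h d hd t ht
    by_contra hne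
    exact h ⟨t, ⟨d, hd, ht⟩, hne⟩
  · rintro h ⟨t, ⟨d, hd, ht⟩, hne⟩
    exact hne (h d hd t ht)

lemma sem_boxdot_eq_one_iff (φ : Formula AP) (ρ : ℕ → S → unitInterval) (x : S) :
    sem L π (boxdot φ) ρ x = 1 ↔
      (∃ t, L.LeadsTo x t) ∧ ∀ t, L.LeadsTo x t → sem L π φ ρ t = 1 := by
  rw [PNTS.exists_leadsTo_iff]
  by_cases h : ∃ d, L.trans x d
  · have ht : (1 : unitInterval) = ⊤ := rfl
    rw [sem_boxdot_of_trans φ ρ h, sem_box, ht, iInf₂_eq_top, ← ht]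
    simp only [avg_eq_one_iff, h, true_and]
    constructor
    · rintro h t ⟨d, hd, ht⟩
      exact h d hd t ht
    · intro h d hd t ht
      exact h t ⟨d, hd, ht⟩
  · rw [sem_boxdot_of_not_trans φ ρ h]
    simp [h]

end Formula

end Modalities

/-! ### Probabilities of reachability events -/

section Measures

universe u

variable {S : Type u} {L : PNTS S}

/-- The maximal paths that reach `C` and stay in `B` until then. -/
def untilSet (L : PNTS S) (B C : Set S) : Set (MaxPath L) :=
  {w | ∃ n, (∃ t, w.state n = some t ∧ t ∈ C) ∧ ∀ m < n, ∃ t, w.state m = some t ∧ t ∈ B}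

/-- The maximal paths that, from position `n` on, reach `C` within `k` steps and stay in `B` until
then. -/
def untilWithin (L : PNTS S) (B C : Set S) (n k : ℕ) : Set (MaxPath L) :=
  {w | ∃ j ≤ k, (∃ t, w.state (n + j) = some t ∧ t ∈ C) ∧
    ∀ i < j, ∃ t, w.state (n + i) = some t ∧ t ∈ B}

lemma isOpen_cyl {n : ℕ} (x : Fin (n + 1) → S) : IsOpen (cyl L x) :=
  TopologicalSpace.isOpen_generateFrom_of_mem ⟨n, x, rfl⟩

lemma mem_cyl_snoc {n : ℕ} {x : Fin (n + 1) → S} {t : S} {w : MaxPath L} :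
    w ∈ cyl L (Fin.snoc x t : Fin (n + 1 + 1) → S) ↔ w ∈ cyl L x ∧ w.state (n + 1) = some t := by
  simp only [cyl, Set.mem_ofPred_eq]
  rw [Fin.forall_fin_succ']
  simp

/-- An event that depends on a single entry is open: a point of the event is contained in a basic
open set that fixes this entry. -/
lemma isOpen_state (n : ℕ) (A : Set S) :
    IsOpen {w : MaxPath L | ∃ t, w.state n = some t ∧ t ∈ A} := by
  have : {w : MaxPath L | ∃ t, w.state n = some t ∧ t ∈ A} =
      ⋃ (x : Fin (n + 1) → S) (_ : x (Fin.last n) ∈ A), cyl L x := by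
    ext w
    simp only [Set.mem_ofPred_eq, Set.mem_iUnion, exists_prop]
    constructor
    · rintro ⟨t, ht, htA⟩
      have hsome : ∀ i ≤ n, w.state i ≠ none := by
        intro i hi h
        have : ∀ j, w.state (i + j) = none := by
          intro j
          induction j with
          | zero => exact h
          | succ j ih => exact w.initial _ ih
        have h' := this (n - i)
        rw [Nat.add_sub_cancel' hi, ht] at h'
        simp at h'
      choose f hf using fun i : Fin (n + 1) =>
        Option.ne_none_iff_exists'.1 (hsome i (by omega))
      refine ⟨f, ?_, hf⟩
      have := hf (Fin.last n)
      simp only [Fin.val_last, ht, Option.some.injEq] at this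
      exact this ▸ htA
    · rintro ⟨x, hx, hw⟩
      exact ⟨_, hw (Fin.last n), hx⟩
  rw [this]
  exact isOpen_biUnion fun x _ => isOpen_cyl x

lemma measurableSet_state (n : ℕ) (A : Set S) :
    MeasurableSet {w : MaxPath L | ∃ t, w.state n = some t ∧ t ∈ A} :=
  (isOpen_state n A).measurableSet

lemma measurableSet_untilWithin (B C : Set S) (n k : ℕ) :
    MeasurableSet (untilWithin L B C n k) := by
  have : untilWithin L B C n k = ⋃ (j : ℕ) (_ : j ≤ k),
      ({w : MaxPath L | ∃ t, w.state (n + j) = some t ∧ t ∈ C} ∩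
        ⋂ (i : ℕ) (_ : i < j), {w : MaxPath L | ∃ t, w.state (n + i) = some t ∧ t ∈ B}) := by
    ext w
    simp [untilWithin, and_left_comm]
  rw [this]
  exact MeasurableSet.iUnion fun j => MeasurableSet.iUnion fun _ =>
    (measurableSet_state _ _).inter
      (MeasurableSet.iInter fun i => MeasurableSet.iInter fun _ => measurableSet_state _ _)

namespace Scheduler

variable (σ : Scheduler L) (s : S)

lemma measure_cyl_snoc {n : ℕ} (x : Fin (n + 1) → S) (hx : x 0 = s) (t : S) :
    σ.measure s (cyl L (Fin.snoc x t : Fin (n + 1 + 1) → S)) =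
      σ.measure s (cyl L x) * σ.prob x t := by
  have hm := (σ.isPathMeasure_measure s).2
  have h0 : (Fin.snoc x t : Fin (n + 1 + 1) → S) 0 = s := by
    rw [← hx]
    exact Fin.snoc_castSucc (α := fun _ => S) t x 0
  have hseg : ∀ i : Fin n, initSeg (Fin.snoc x t : Fin (n + 1 + 1) → S) i.castSucc =
      initSeg x i := by
    intro i
    funext j
    exact Fin.snoc_castSucc (α := fun _ => S) t x (j.castLE (by omega))
  have hlast : initSeg (Fin.snoc x t : Fin (n + 1 + 1) → S) (Fin.last n) = x := by
    funext j
    exact Fin.snoc_castSucc (α := fun _ => S) t x j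
  rw [(hm _ _).1 h0, (hm _ _).1 hx, Fin.prod_univ_castSucc]
  congr 1
  · refine Finset.prod_congr rfl fun i _ => ?_
    rw [Fin.succ_castSucc, Fin.snoc_castSucc]
    exact congrArg (fun y => σ.prob y (x i.succ)) (hseg i)
  · rw [Fin.succ_last, Fin.snoc_last]
    exact congrArg (fun y => σ.prob y t) hlast

/-- The first-step decomposition at a history `x`. It is not a matter of additivity alone, as `x`
may have uncountably many continuations: the continuations of positive probability are countably
many and already exhaust the mass of `cyl L x`. -/
lemma measure_cyl_inter {n : ℕ} (x : Fin (n + 1) → S) (hx : x 0 = s) {A : Set (MaxPath L)}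
    (hA : MeasurableSet A) (hsome : ∀ w ∈ A, w.state (n + 1) ≠ none) :
    σ.measure s (cyl L x ∩ A) =
      ∑' t, σ.measure s (cyl L (Fin.snoc x t : Fin (n + 1 + 1) → S) ∩ A) := by
  have hprob := (σ.isPathMeasure_measure s).1
  have hzero : ∀ t, σ.prob x t = 0 →
      σ.measure s (cyl L (Fin.snoc x t : Fin (n + 1 + 1) → S) ∩ A) = 0 := by
    intro t ht
    refine measure_mono_null Set.inter_subset_left ?_
    rw [measure_cyl_snoc σ s x hx, ht, mul_zero]
  cases hc : σ.choice n x with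
  | none =>
    have hp : ∀ t, σ.prob x t = 0 := fun t => by simp [Scheduler.prob, hc]
    have hempty : cyl L x ∩ A = ∅ := by
      refine Set.eq_empty_of_forall_notMem fun w hw => ?_
      obtain ⟨t, ht⟩ := Option.ne_none_iff_exists'.1 (hsome w hw.2)
      obtain ⟨d, hd, -⟩ := w.step n _ t (hw.1 (Fin.last n)) ht
      exact (σ.eq_none_iff n x).1 hc d hd
    rw [hempty, measure_empty]
    exact (ENNReal.tsum_eq_zero.2 fun t => hzero t (hp t)).symm
  | some d =>
    have hp : ∀ t, σ.prob x t = d t := fun t => by simp [Scheduler.prob, hc]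
    have hcount : d.support.Countable := d.support_countable
    have hdisj : d.support.PairwiseDisjoint
        fun t => cyl L (Fin.snoc x t : Fin (n + 1 + 1) → S) := by
      intro t _ t' _ hne
      refine Set.disjoint_left.2 fun w hw hw' => hne ?_
      have h1 := (mem_cyl_snoc.1 hw).2
      rw [(mem_cyl_snoc.1 hw').2, Option.some.injEq] at h1
      exact h1.symm
    have hmeas : ∀ t, MeasurableSet (cyl L (Fin.snoc x t : Fin (n + 1 + 1) → S)) :=
      fun t => (isOpen_cyl _).measurableSet
    have hsub : (⋃ t ∈ d.support, cyl L (Fin.snoc x t : Fin (n + 1 + 1) → S)) ⊆ cyl L x :=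
      Set.iUnion₂_subset fun t _ w hw => (mem_cyl_snoc.1 hw).1
    have hsupp : ∀ g : S → ℝ≥0∞, (∀ t, d t = 0 → g t = 0) →
        ∑' t : d.support, g t = ∑' t, g t := fun g hg =>
      tsum_subtype_eq_of_support_subset fun t ht h => ht (hg t h)
    have hfull : σ.measure s (⋃ t ∈ d.support, cyl L (Fin.snoc x t : Fin (n + 1 + 1) → S)) =
        σ.measure s (cyl L x) := by
      rw [measure_biUnion hcount hdisj fun t _ => hmeas t,
        hsupp (fun t => σ.measure s (cyl L (Fin.snoc x t : Fin (n + 1 + 1) → S)))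
          fun t ht => by rw [measure_cyl_snoc σ s x hx, hp, ht, mul_zero]]
      simp only [measure_cyl_snoc σ s x hx, hp]
      rw [ENNReal.tsum_mul_left, d.tsum_coe, mul_one]
    have hae := ae_eq_of_subset_of_measure_ge hsub hfull.ge
      (MeasurableSet.biUnion hcount fun t _ => hmeas t).nullMeasurableSet (measure_ne_top _ _)
    -- Up to a null set, `cyl L x` is the countable union of the relevant continuations.
    rw [← measure_congr (hae.inter (ae_eq_refl A)), Set.iUnion₂_inter,
      measure_biUnion hcount
        (hdisj.mono fun t => Set.inter_subset_left) fun t _ => (hmeas t).inter hA]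
    exact hsupp (fun t => σ.measure s (cyl L (Fin.snoc x t : Fin (n + 1 + 1) → S) ∩ A))
      fun t ht => hzero t ((hp t).trans ht)

open Classical in
/-- The conditional probability, given the history `x`, of reaching `C` within `k` further steps
and staying in `B` until then. -/
noncomputable def untilProb (B C : Set S) : ℕ → (n : ℕ) → (Fin (n + 1) → S) → ℝ≥0∞
  | 0, n, x => if x (Fin.last n) ∈ C then 1 else 0
  | k + 1, n, x =>
    if x (Fin.last n) ∈ C then 1
    else if x (Fin.last n) ∈ B then ∑' t, σ.prob x t * untilProb B C k (n + 1) (Fin.snoc x t)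
    else 0

variable {B C : Set S}

lemma measure_cyl_inter_untilWithin (k : ℕ) {n : ℕ} (x : Fin (n + 1) → S) (hx : x 0 = s) :
    σ.measure s (cyl L x ∩ untilWithin L B C n k) =
      σ.measure s (cyl L x) * σ.untilProb B C k n x := by
  induction k generalizing n with
  | zero =>
    by_cases hC : x (Fin.last n) ∈ C
    · have : cyl L x ∩ untilWithin L B C n 0 = cyl L x := by
        refine Set.inter_eq_left.2 fun w hw => ⟨0, le_rfl, ⟨_, hw (Fin.last n), hC⟩, ?_⟩
        simp
      rw [this]
      simp [untilProb, hC]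
    · have : cyl L x ∩ untilWithin L B C n 0 = ∅ := by
        refine Set.eq_empty_of_forall_notMem ?_
        rintro w ⟨hw, j, hj, ⟨t, ht, htC⟩, -⟩
        obtain rfl : j = 0 := by omega
        have := hw (Fin.last n)
        simp only [Fin.val_last] at this
        rw [add_zero, this, Option.some.injEq] at ht
        exact hC (ht ▸ htC)
      rw [this]
      simp [untilProb, hC]
  | succ k ih =>
    by_cases hC : x (Fin.last n) ∈ C
    · have : cyl L x ∩ untilWithin L B C n (k + 1) = cyl L x := by
        refine Set.inter_eq_left.2 fun w hw => ⟨0, by omega, ⟨_, hw (Fin.last n), hC⟩, ?_⟩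
        simp
      rw [this]
      simp [untilProb, hC]
    have hpos : ∀ w ∈ cyl L x, ∀ j, (∃ t, w.state (n + j) = some t ∧ t ∈ C) → j ≠ 0 := by
      rintro w hw j ⟨t, ht, htC⟩ rfl
      have := hw (Fin.last n)
      simp only [Fin.val_last] at this
      rw [add_zero, this, Option.some.injEq] at ht
      exact hC (ht ▸ htC)
    by_cases hB : x (Fin.last n) ∈ B
    · have hshift : cyl L x ∩ untilWithin L B C n (k + 1) =
          cyl L x ∩ untilWithin L B C (n + 1) k := by
        ext w
        refine and_congr_right fun hw => ?_
        constructor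
        · rintro ⟨j, hj, hjC, hjB⟩
          obtain ⟨j, rfl⟩ := Nat.exists_eq_succ_of_ne_zero (hpos w hw j hjC)
          refine ⟨j, by omega, ?_, fun i hi => ?_⟩
          · rwa [show n + 1 + j = n + j.succ by omega]
          · rw [show n + 1 + i = n + (i + 1) by omega]
            exact hjB (i + 1) (by omega)
        · rintro ⟨j, hj, hjC, hjB⟩
          refine ⟨j + 1, by omega, ?_, fun i hi => ?_⟩
          · rwa [show n + (j + 1) = n + 1 + j by omega]
          · cases i with
            | zero => exact ⟨_, hw (Fin.last n), hB⟩
            | succ i =>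
              rw [show n + (i + 1) = n + 1 + i by omega]
              exact hjB i (by omega)
      have hsome : ∀ w ∈ untilWithin L B C (n + 1) k, w.state (n + 1) ≠ none := by
        rintro w ⟨j, -, ⟨t, ht, -⟩, hj⟩ h
        cases j with
        | zero => simp [h] at ht
        | succ j =>
          obtain ⟨t, ht, -⟩ := hj 0 (by omega)
          simp [h] at ht
      rw [hshift, measure_cyl_inter σ s x hx (measurableSet_untilWithin _ _ _ _) hsome]
      simp only [untilProb, hC, hB, if_true, if_false]
      rw [← ENNReal.tsum_mul_left]
      refine tsum_congr fun t => ?_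
      rw [ih, measure_cyl_snoc σ s x hx, mul_assoc]
      rw [← hx]
      exact Fin.snoc_castSucc (α := fun _ => S) t x 0
    · have : cyl L x ∩ untilWithin L B C n (k + 1) = ∅ := by
        refine Set.eq_empty_of_forall_notMem ?_
        rintro w ⟨hw, j, hj, hjC, hjB⟩
        obtain ⟨t, ht, htB⟩ := hjB 0 (Nat.pos_of_ne_zero (hpos w hw j hjC))
        have := hw (Fin.last n)
        simp only [Fin.val_last] at this
        rw [add_zero, this, Option.some.injEq] at ht
        exact hB (ht ▸ htB)
      rw [this]
      simp [untilProb, hC, hB]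

lemma measure_cyl_const : σ.measure s (cyl L fun _ : Fin 1 => s) = 1 := by
  rw [((σ.isPathMeasure_measure s).2 0 fun _ => s).1 rfl]
  simp

lemma measure_eq_measure_cyl_const_inter (A : Set (MaxPath L)) :
    σ.measure s A = σ.measure s (cyl L (fun _ : Fin 1 => s) ∩ A) := by
  have hprob := (σ.isPathMeasure_measure s).1
  have hae : cyl L (fun _ : Fin 1 => s) =ᵐ[σ.measure s] (Set.univ : Set (MaxPath L)) := by
    rw [ae_eq_univ, prob_compl_eq_zero_iff (isOpen_cyl _).measurableSet]
    exact σ.measure_cyl_const s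
  rw [measure_congr (hae.inter (ae_eq_refl A)), Set.univ_inter]

lemma measure_untilSet :
    σ.measure s (untilSet L B C) = ⨆ k, σ.untilProb B C k 0 fun _ => s := by
  have hU : untilSet L B C = ⋃ k, untilWithin L B C 0 k := by
    ext w
    simp only [untilSet, untilWithin, zero_add, Set.mem_ofPred_eq, Set.mem_iUnion]
    constructor
    · rintro ⟨n, h⟩
      exact ⟨n, n, le_rfl, h⟩
    · rintro ⟨k, n, -, h⟩
      exact ⟨n, h⟩
  have hmono : Monotone fun k => untilWithin L B C 0 k := by
    rintro k k' hk w ⟨j, hj, h⟩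
    exact ⟨j, hj.trans hk, h⟩
  rw [hU, hmono.measure_iUnion]
  refine iSup_congr fun k => ?_
  rw [measure_eq_measure_cyl_const_inter, measure_cyl_inter_untilWithin σ s k _ rfl,
    measure_cyl_const, one_mul]

open Classical in
lemma measure_next (A : Set S) :
    σ.measure s {w | ∃ t, w.state 1 = some t ∧ t ∈ A} =
      ∑' t, σ.prob (fun _ : Fin 1 => s) t * (if t ∈ A then 1 else 0) := by
  rw [measure_eq_measure_cyl_const_inter, measure_cyl_inter σ s (n := 0) _ rfl
    (measurableSet_state 1 A)]
  · refine tsum_congr fun t => ?_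
    have h1 := measure_cyl_snoc σ s (fun _ : Fin 1 => s) rfl t
    rw [measure_cyl_const, one_mul] at h1
    split_ifs with ht
    · rw [mul_one, ← h1]
      congr 1
      exact Set.inter_eq_left.2 fun w hw => ⟨t, (mem_cyl_snoc.1 hw).2, ht⟩
    · rw [mul_zero]
      convert measure_empty (μ := σ.measure s)
      refine Set.eq_empty_of_forall_notMem ?_
      rintro w ⟨hw, t', ht', hA⟩
      have := (mem_cyl_snoc.1 hw).2
      rw [zero_add, ht', Option.some.injEq] at this
      exact ht (this ▸ hA)
  · rintro w ⟨t, ht, -⟩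
    simp [ht]

end Scheduler

end Measures

/-! ### Optimal reachability probabilities -/

section Optimal

universe u v

variable {S : Type u} {L : PNTS S}

lemma tsum_mul_iSup_of_monotone (d : S → ℝ≥0∞) {u : ℕ → S → ℝ≥0∞} (hu : Monotone u) :
    ∑' t, d t * ⨆ k, u k t = ⨆ k, ∑' t, d t * u k t := by
  simp_rw [ENNReal.mul_iSup, ENNReal.tsum_eq_iSup_sum]
  rw [iSup_comm]
  refine iSup_congr fun F => ENNReal.finsetSum_iSup_of_monotone fun t k k' hk => ?_
  gcongr
  exact hu hk t

namespace Scheduler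

open Classical in
/-- The scheduler given by a choice function that is only relevant at histories whose last state
has a transition. -/
noncomputable def ofPick (p : (n : ℕ) → (Fin (n + 1) → S) → PMF S)
    (hp : ∀ n x, (∃ d, L.trans (x (Fin.last n)) d) → L.trans (x (Fin.last n)) (p n x)) :
    Scheduler L where
  choice n x := if ∃ d, L.trans (x (Fin.last n)) d then some (p n x) else none
  eq_none_iff n x := by simp
  trans_of_eq_some n x d h := by
    split_ifs at h with h'
    rw [← Option.some.inj h]
    exact hp n x h'

/-- There is a scheduler whose choice after `n` steps in state `s` satisfies `P n s`, provided that
`P n s` holds for some transition of `s` whenever there are any. -/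
lemma exists_forall_trans (P : ℕ → S → PMF S → Prop)
    (hP : ∀ n s, (∃ d, L.trans s d) → ∃ d, L.trans s d ∧ P n s d) :
    ∃ σ : Scheduler L, ∀ n x d, σ.choice n x = some d → P n (x (Fin.last n)) d := by
  classical
  choose p hp using fun (n : ℕ) (s : S) => show ∃ d : PMF S, (∃ d, L.trans s d) →
      L.trans s d ∧ P n s d by
    by_cases h : ∃ d, L.trans s d
    · obtain ⟨d, hd⟩ := hP n s h
      exact ⟨d, fun _ => hd⟩
    · exact ⟨PMF.pure s, fun h' => absurd h' h⟩
  refine ⟨ofPick (fun n x => p n (x (Fin.last n))) fun n x h => (hp n _ h).1, fun n x d h => ?_⟩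
  simp only [ofPick] at h
  split_ifs at h with h'
  rw [← Option.some.inj h]
  exact (hp n _ h').2

instance : Nonempty (Scheduler L) :=
  ⟨(exists_forall_trans (fun _ _ _ => True) fun _ _ ⟨d, hd⟩ => ⟨d, hd, trivial⟩).choose⟩

lemma prob_of_eq_some {σ : Scheduler L} {n : ℕ} {x : Fin (n + 1) → S} {d : PMF S}
    (h : σ.choice n x = some d) (t : S) : σ.prob x t = d t := by
  simp [Scheduler.prob, h]

lemma prob_of_not_trans (σ : Scheduler L) {n : ℕ} {x : Fin (n + 1) → S}
    (h : ¬ ∃ d, L.trans (x (Fin.last n)) d) (t : S) : σ.prob x t = 0 := by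
  simp [Scheduler.prob, (σ.eq_none_iff n x).2 (not_exists.1 h)]

lemma exists_choice_eq_some (σ : Scheduler L) {n : ℕ} {x : Fin (n + 1) → S}
    (h : ∃ d, L.trans (x (Fin.last n)) d) :
    ∃ d, L.trans (x (Fin.last n)) d ∧ σ.choice n x = some d := by
  obtain ⟨d, hd⟩ := Option.ne_none_iff_exists'.1
    (mt (σ.eq_none_iff n x).1 fun h' => h.elim h')
  exact ⟨d, σ.trans_of_eq_some n x d hd, hd⟩

/-- The scheduler that behaves as `σ` does after the first state `s`. -/
def tail (σ : Scheduler L) (s : S) : Scheduler L where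
  choice n x := σ.choice (n + 1) (Fin.cons s x : Fin (n + 1 + 1) → S)
  eq_none_iff n x := σ.eq_none_iff (n + 1) (Fin.cons s x : Fin (n + 1 + 1) → S)
  trans_of_eq_some n x := σ.trans_of_eq_some (n + 1) (Fin.cons s x : Fin (n + 1 + 1) → S)

open Classical in
/-- The scheduler that chooses `d` at the initial state `s` and then behaves as `τ t`, where `t` is
the second state. -/
noncomputable def stitch {s : S} {d : PMF S} (hd : L.trans s d) (τ : S → Scheduler L) :
    Scheduler L where
  choice
    | 0, x => if x 0 = s then some d else (τ (x 0)).choice 0 x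
    | n + 1, x => (τ (x 1)).choice n (Fin.tail x)
  eq_none_iff
    | 0, x => by
      by_cases h : x 0 = s
      · simpa [h] using ⟨d, hd⟩
      · simpa [h] using (τ (x 0)).eq_none_iff 0 x
    | n + 1, x => (τ (x 1)).eq_none_iff n (Fin.tail x)
  trans_of_eq_some
    | 0, x, e => by
      by_cases h : x 0 = s
      · simp only [h, if_true, Option.some.injEq]
        rintro rfl
        change L.trans (x 0) d
        rwa [h]
      · simpa [h] using (τ (x 0)).trans_of_eq_some 0 x e
    | n + 1, x, e => (τ (x 1)).trans_of_eq_some n (Fin.tail x) e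

lemma prob_stitch {s : S} {d : PMF S} (hd : L.trans s d) (τ : S → Scheduler L) (t : S) :
    (stitch hd τ).prob (fun _ : Fin 1 => s) t = d t :=
  prob_of_eq_some (by simp [stitch]) t

variable {B C : Set S}

lemma untilProb_le_succ (σ : Scheduler L) (k n : ℕ) (x : Fin (n + 1) → S) :
    σ.untilProb B C k n x ≤ σ.untilProb B C (k + 1) n x := by
  induction k generalizing n with
  | zero =>
    by_cases hC : x (Fin.last n) ∈ C <;> simp [untilProb, hC]
  | succ k ih =>
    rw [untilProb, untilProb]
    split_ifs
    · exact le_rfl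
    · gcongr
      exact ih _ _
    · exact le_rfl

lemma iSup_untilProb_of_mem_of_notMem (σ : Scheduler L) {n : ℕ} {x : Fin (n + 1) → S}
    (hB : x (Fin.last n) ∈ B) (hC : x (Fin.last n) ∉ C) :
    ⨆ k, σ.untilProb B C k n x =
      ∑' t, σ.prob x t * ⨆ k, σ.untilProb B C k (n + 1) (Fin.snoc x t) := by
  rw [tsum_mul_iSup_of_monotone _
      (u := fun k t => σ.untilProb B C k (n + 1) (Fin.snoc x t))
      (monotone_nat_of_le_succ fun k t => σ.untilProb_le_succ k _ _),
    ← sup_iSup_nat_succ]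
  simp [untilProb, hB, hC]

lemma iSup_untilProb_of_mem (σ : Scheduler L) {n : ℕ} {x : Fin (n + 1) → S}
    (hC : x (Fin.last n) ∈ C) : 1 ≤ ⨆ k, σ.untilProb B C k n x :=
  le_iSup_of_le 0 (by simp [untilProb, hC])

lemma untilProb_tail (σ : Scheduler L) (s : S) (k n : ℕ) (x : Fin (n + 1) → S) :
    (σ.tail s).untilProb B C k n x = σ.untilProb B C k (n + 1) (Fin.cons s x) := by
  have hlast : ∀ (n : ℕ) (x : Fin (n + 1) → S),
      (Fin.cons s x : Fin (n + 1 + 1) → S) (Fin.last (n + 1)) = x (Fin.last n) := fun _ _ => rfl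
  induction k generalizing n with
  | zero => rfl
  | succ k ih =>
    simp only [untilProb, hlast, ih, Fin.cons_snoc_eq_snoc_cons]
    rfl

lemma untilProb_stitch {s : S} {d : PMF S} (hd : L.trans s d) (τ : S → Scheduler L) (k n : ℕ)
    (x : Fin (n + 1) → S) :
    (stitch hd τ).untilProb B C k (n + 1) (Fin.cons s x) = (τ (x 0)).untilProb B C k n x := by
  have hlast : ∀ (n : ℕ) (x : Fin (n + 1) → S),
      (Fin.cons s x : Fin (n + 1 + 1) → S) (Fin.last (n + 1)) = x (Fin.last n) := fun _ _ => rfl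
  have hsnoc : ∀ (n : ℕ) (x : Fin (n + 1) → S) (t : S),
      (Fin.snoc x t : Fin (n + 1 + 1) → S) 0 = x 0 := fun n x t =>
    Fin.snoc_castSucc (α := fun _ => S) t x 0
  induction k generalizing n with
  | zero => rfl
  | succ k ih =>
    simp only [untilProb, hlast, ← Fin.cons_snoc_eq_snoc_cons, ih, hsnoc]
    rfl

lemma snoc_const_eq_cons (s t : S) :
    (Fin.snoc (fun _ : Fin 1 => s) t : Fin 2 → S) = Fin.cons s fun _ : Fin 1 => t := by
  funext i
  fin_cases i <;> rfl

/-- The supremal probability of an until event is closed under one step of the best transition: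
schedulers that are nearly optimal at the successors are stitched together. -/
lemma tsum_mul_iSup_measure_untilSet_le {s : S} (hB : s ∈ B) (hC : s ∉ C) {d : PMF S}
    (hd : L.trans s d) :
    ∑' t, d t * ⨆ σ : Scheduler L, σ.measure t (untilSet L B C) ≤
      ⨆ σ : Scheduler L, σ.measure s (untilSet L B C) := by
  refine ENNReal.le_of_forall_pos_le_add fun ε hε _ => ?_
  have hex : ∀ t, ∃ τ : Scheduler L,
      ⨆ σ : Scheduler L, σ.measure t (untilSet L B C) ≤ τ.measure t (untilSet L B C) + ε := by
    intro t
    by_contra! h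
    have h1 : ⨆ σ : Scheduler L, σ.measure t (untilSet L B C) ≤ 1 := iSup_le fun σ =>
      have := (σ.isPathMeasure_measure t).1
      prob_le_one
    have h2 : (⨆ σ : Scheduler L, σ.measure t (untilSet L B C)) + ε ≤
        ⨆ σ : Scheduler L, σ.measure t (untilSet L B C) := by
      rw [ENNReal.iSup_add]
      exact iSup_le fun σ => (h σ).le
    exact h2.not_gt (ENNReal.lt_add_right (h1.trans_lt ENNReal.one_lt_top).ne
      (by exact_mod_cast hε.ne'))
  choose τ hτ using hex
  calc ∑' t, d t * ⨆ σ : Scheduler L, σ.measure t (untilSet L B C)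
      ≤ ∑' t, d t * ((τ t).measure t (untilSet L B C) + ε) := by
        gcongr with t
        exact hτ t
    _ = (stitch hd τ).measure s (untilSet L B C) + ε := by
        simp_rw [mul_add]
        rw [ENNReal.tsum_add, ENNReal.tsum_mul_right, d.tsum_coe, one_mul, measure_untilSet,
          iSup_untilProb_of_mem_of_notMem _ (n := 0) hB hC]
        congr 1
        refine tsum_congr fun t => ?_
        rw [prob_stitch, measure_untilSet, snoc_const_eq_cons]
        simp only [untilProb_stitch]
    _ ≤ _ := by
        gcongr
        exact le_iSup (fun σ : Scheduler L => σ.measure s (untilSet L B C)) _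

/-- The infimal probability of an until event is closed under one step of the worst transition:
after its first choice, a scheduler continues as a scheduler started at the successor. -/
lemma measure_untilSet_ge_tsum (σ : Scheduler L) {s : S} (hB : s ∈ B) (hC : s ∉ C) {d : PMF S}
    (hd : σ.choice 0 (fun _ => s) = some d) :
    ∑' t, d t * ⨅ τ : Scheduler L, τ.measure t (untilSet L B C) ≤
      σ.measure s (untilSet L B C) := by
  rw [σ.measure_untilSet, iSup_untilProb_of_mem_of_notMem _ (n := 0) hB hC]
  refine ENNReal.tsum_le_tsum fun t => ?_
  rw [prob_of_eq_some hd, snoc_const_eq_cons]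
  gcongr
  refine (iInf_le _ (σ.tail s)).trans_eq ?_
  rw [measure_untilSet]
  simp only [untilProb_tail]

/-- Any pre-fixed point of the one-step operator for the best transitions bounds the probability
of an until event from above. -/
lemma measure_untilSet_le (σ : Scheduler L) {f : S → ℝ≥0∞} (hf1 : ∀ s ∈ C, 1 ≤ f s)
    (hf : ∀ s ∈ B, s ∉ C → ∀ d, L.trans s d → ∑' t, d t * f t ≤ f s) (s : S) :
    σ.measure s (untilSet L B C) ≤ f s := by
  have key : ∀ (k n : ℕ) (x : Fin (n + 1) → S), σ.untilProb B C k n x ≤ f (x (Fin.last n)) := by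
    intro k
    induction k with
    | zero =>
      intro n x
      rw [untilProb]
      split_ifs with hC
      · exact hf1 _ hC
      · exact zero_le
    | succ k ih =>
      intro n x
      rw [untilProb]
      split_ifs with hC hB
      · exact hf1 _ hC
      · by_cases h : ∃ d, L.trans (x (Fin.last n)) d
        · obtain ⟨d, hd, hd'⟩ := σ.exists_choice_eq_some h
          refine le_trans (ENNReal.tsum_le_tsum fun t => ?_) (hf _ hB hC d hd)
          rw [prob_of_eq_some hd']
          gcongr
          simpa using ih (n + 1) (Fin.snoc x t)
        · simp [σ.prob_of_not_trans h]
      · exact zero_le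
  rw [measure_untilSet]
  exact iSup_le fun k => key k 0 _

/-- Any pre-fixed point of the one-step operator for the worst transitions bounds the infimal
probability of an until event from above. As the infima need not be attained, the scheduler that
shows this makes an error of at most `ε / 2 ^ (n + 1)` at step `n`. -/
lemma iInf_measure_untilSet_le {f : S → ℝ≥0∞} (hftop : ∀ s, f s ≠ ∞) (hf1 : ∀ s ∈ C, 1 ≤ f s)
    (hf : ∀ s ∈ B, s ∉ C → (∃ d, L.trans s d) →
      ⨅ (d : PMF S) (_ : L.trans s d), ∑' t, d t * f t ≤ f s) (s : S) :
    ⨅ σ : Scheduler L, σ.measure s (untilSet L B C) ≤ f s := by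
  refine ENNReal.le_of_forall_pos_le_add fun ε hε _ => ?_
  have hε0 : (ε : ℝ≥0∞) ≠ 0 := by exact_mod_cast hε.ne'
  obtain ⟨σ, hσ⟩ := exists_forall_trans (L := L)
    (fun n s d => s ∈ B → s ∉ C → ∑' t, d t * f t ≤ f s + ε * 2⁻¹ ^ (n + 1)) (by
      intro n s h
      by_cases hBC : s ∈ B ∧ s ∉ C
      · have hlt : ⨅ (d : PMF S) (_ : L.trans s d), ∑' t, d t * f t <
            f s + ε * 2⁻¹ ^ (n + 1) :=
          (hf s hBC.1 hBC.2 h).trans_lt (ENNReal.lt_add_right (hftop s)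
            (mul_ne_zero hε0 (pow_ne_zero _ (by simp))))
        simp only [iInf_lt_iff] at hlt
        obtain ⟨d, hd, hlt⟩ := hlt
        exact ⟨d, hd, fun _ _ => hlt.le⟩
      · obtain ⟨d, hd⟩ := h
        exact ⟨d, hd, fun hB hC => absurd ⟨hB, hC⟩ hBC⟩)
  have key : ∀ (k n : ℕ) (x : Fin (n + 1) → S),
      σ.untilProb B C k n x ≤ f (x (Fin.last n)) + ε * 2⁻¹ ^ n := by
    intro k
    induction k with
    | zero =>
      intro n x
      rw [untilProb]
      split_ifs with hC
      · exact le_add_right (hf1 _ hC)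
      · exact zero_le
    | succ k ih =>
      intro n x
      rw [untilProb]
      split_ifs with hC hB
      · exact le_add_right (hf1 _ hC)
      · by_cases h : ∃ d, L.trans (x (Fin.last n)) d
        · obtain ⟨d, hd, hd'⟩ := σ.exists_choice_eq_some h
          calc ∑' t, σ.prob x t * σ.untilProb B C k (n + 1) (Fin.snoc x t)
              ≤ ∑' t, d t * (f t + ε * 2⁻¹ ^ (n + 1)) := by
                refine ENNReal.tsum_le_tsum fun t => ?_
                rw [prob_of_eq_some hd']
                gcongr
                simpa using ih (n + 1) (Fin.snoc x t)
            _ = ∑' t, d t * f t + ε * 2⁻¹ ^ (n + 1) := by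
                simp_rw [mul_add]
                rw [ENNReal.tsum_add, ENNReal.tsum_mul_right, d.tsum_coe, one_mul]
            _ ≤ f (x (Fin.last n)) + ε * 2⁻¹ ^ (n + 1) + ε * 2⁻¹ ^ (n + 1) := by
                gcongr
                exact hσ n x d hd' hB hC
            _ = f (x (Fin.last n)) + ε * 2⁻¹ ^ n := by
                rw [add_assoc, ← mul_add, pow_succ, ← mul_add, ENNReal.inv_two_add_inv_two,
                  mul_one]
        · simp [σ.prob_of_not_trans h]
      · exact zero_le
  refine (iInf_le _ σ).trans ?_
  rw [measure_untilSet]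
  refine iSup_le fun k => ?_
  simpa using key k 0 fun _ => s

end Scheduler

/-! ### The until operators as least fixed points -/

open Classical in
lemma char_apply (A : Set S) (s : S) : char A s = if s ∈ A then 1 else 0 := by
  simp [char, Set.indicator_apply]

open Classical in
lemma ofReal_char (A : Set S) (s : S) :
    ENNReal.ofReal (char A s) = if s ∈ A then 1 else 0 := by
  rw [char_apply]
  split_ifs <;> simp

lemma char_compl (A : Set S) (s : S) : char Aᶜ s = unitInterval.symm (char A s) := by
  by_cases h : s ∈ A <;> simp [char_apply, h]

lemma char_union (A A' : Set S) (s : S) : char (A ∪ A') s = max (char A s) (char A' s) := by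
  by_cases h : s ∈ A <;> by_cases h' : s ∈ A' <;> simp [char_apply, h, h']

variable {AP : Type v} {π : AP → S → unitInterval} {B C : Set S} {φ₁ φ₂ : Formula AP}

namespace Formula

open Classical in
lemma sem_sup_inf (hB : ∀ ρ, sem L π φ₁ ρ = char B) (hC : ∀ ρ, sem L π φ₂ ρ = char C)
    (θ : Formula AP) (ρ : ℕ → S → unitInterval) (s : S) :
    sem L π (.sup φ₂ (.inf φ₁ θ)) ρ s =
      if s ∈ C then 1 else if s ∈ B then sem L π θ ρ s else 0 := by
  rw [sem_sup, sem_inf, hB, hC, char_apply, char_apply]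
  split_ifs
  · exact max_eq_left unitInterval.le_one'
  · exact max_eq_left unitInterval.le_one'
  · rw [max_eq_right unitInterval.nonneg', min_eq_right unitInterval.le_one']
  · rw [min_eq_left unitInterval.nonneg', max_self]

/-- The supremal probability of an until event, over all schedulers, is the least fixed point of the
one-step operator for `◇`. -/
lemma ofReal_sem_until_dia (hB : ∀ ρ, sem L π φ₁ ρ = char B) (hC : ∀ ρ, sem L π φ₂ ρ = char C)
    (ρ : ℕ → S → unitInterval) (s : S) :
    ENNReal.ofReal (sem L π (.mu 0 (.sup φ₂ (.inf φ₁ (.dia (.var 0))))) ρ s) =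
      ⨆ σ : Scheduler L, σ.measure s (untilSet L B C) := by
  refine le_antisymm ?_ (iSup_le fun σ => ?_)
  · have hle : ∀ t, ⨆ σ : Scheduler L, σ.measure t (untilSet L B C) ≤ 1 := fun t =>
      iSup_le fun σ =>
        have := (σ.isPathMeasure_measure t).1
        prob_le_one
    choose g hg using fun t => exists_ofReal_eq (hle t)
    rw [← hg, ofReal_le_ofReal_unitInterval]
    refine sem_mu_le (f := g) (fun t => ?_) s
    rw [sem_sup_inf hB hC]
    split_ifs with h1 h2
    · rw [← ofReal_le_ofReal_unitInterval, hg]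
      obtain ⟨σ⟩ := (inferInstance : Nonempty (Scheduler L))
      refine le_iSup_of_le σ ?_
      rw [Scheduler.measure_untilSet]
      simpa using σ.iSup_untilProb_of_mem (n := 0) (x := fun _ => t) h1
    · rw [← ofReal_le_ofReal_unitInterval, hg, ofReal_sem_dia]
      refine iSup₂_le fun d hd => ?_
      simp only [sem_var, Function.update_self, hg]
      exact Scheduler.tsum_mul_iSup_measure_untilSet_le h2 h1 hd
    · exact unitInterval.nonneg'
  · refine σ.measure_untilSet_le (f := fun t => ENNReal.ofReal
      (sem L π (.mu 0 (.sup φ₂ (.inf φ₁ (.dia (.var 0))))) ρ t)) (fun t ht => ?_)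
      (fun t htB htC d hd => ?_) s
    · rw [← sem_mu_eq, sem_sup_inf hB hC]
      simp [ht]
    · conv_rhs => rw [← sem_mu_eq, sem_sup_inf hB hC, if_neg htC, if_pos htB, ofReal_sem_dia]
      simp only [sem_var, Function.update_self]
      exact le_iSup₂ (f := fun (d : PMF S) (_ : L.trans t d) => ∑' y, d y * ENNReal.ofReal
        (sem L π (.mu 0 (.sup φ₂ (.inf φ₁ (.dia (.var 0))))) ρ y)) d hd

/-- The infimal probability of an until event, over all schedulers, is the least fixed point of the
one-step operator for `⊡`. -/
lemma ofReal_sem_until_boxdot (hB : ∀ ρ, sem L π φ₁ ρ = char B)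
    (hC : ∀ ρ, sem L π φ₂ ρ = char C) (ρ : ℕ → S → unitInterval) (s : S) :
    ENNReal.ofReal (sem L π (.mu 0 (.sup φ₂ (.inf φ₁ (boxdot (.var 0))))) ρ s) =
      ⨅ σ : Scheduler L, σ.measure s (untilSet L B C) := by
  refine le_antisymm ?_ ?_
  · have hle : ∀ t, ⨅ σ : Scheduler L, σ.measure t (untilSet L B C) ≤ 1 := fun t => by
      obtain ⟨σ⟩ := (inferInstance : Nonempty (Scheduler L))
      have := (σ.isPathMeasure_measure t).1
      exact (iInf_le _ σ).trans prob_le_one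
    choose g hg using fun t => exists_ofReal_eq (hle t)
    rw [← hg, ofReal_le_ofReal_unitInterval]
    refine sem_mu_le (f := g) (fun t => ?_) s
    rw [sem_sup_inf hB hC]
    split_ifs with h1 h2
    · rw [← ofReal_le_ofReal_unitInterval, hg]
      refine le_iInf fun σ => ?_
      rw [Scheduler.measure_untilSet]
      simpa using σ.iSup_untilProb_of_mem (n := 0) (x := fun _ => t) h1
    · by_cases h : ∃ d, L.trans t d
      · rw [← ofReal_le_ofReal_unitInterval, hg, ofReal_sem_boxdot _ _ h]
        refine le_iInf fun σ => ?_
        obtain ⟨d, hd, hd'⟩ := σ.exists_choice_eq_some (n := 0) (x := fun _ => t) h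
        refine (iInf₂_le d hd).trans ?_
        simp only [sem_var, Function.update_self, hg]
        exact σ.measure_untilSet_ge_tsum h2 h1 hd'
      · rw [sem_boxdot_of_not_trans _ _ h]
        exact unitInterval.nonneg'
    · exact unitInterval.nonneg'
  · refine Scheduler.iInf_measure_untilSet_le (f := fun t => ENNReal.ofReal
      (sem L π (.mu 0 (.sup φ₂ (.inf φ₁ (boxdot (.var 0))))) ρ t))
      (fun _ => ENNReal.ofReal_ne_top) (fun t ht => ?_) (fun t htB htC h => ?_) s
    · rw [← sem_mu_eq, sem_sup_inf hB hC]
      simp [ht]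
    · conv_rhs =>
        rw [← sem_mu_eq, sem_sup_inf hB hC, if_neg htC, if_pos htB, ofReal_sem_boxdot _ _ h]
      simp only [sem_var, Function.update_self, le_refl]

lemma ofReal_sem_dia_char {φ : Formula AP} {A : Set S} {ρ : ℕ → S → unitInterval}
    (hA : sem L π φ ρ = char A) (s : S) :
    ENNReal.ofReal (sem L π (.dia φ) ρ s) =
      ⨆ σ : Scheduler L, σ.measure s {w | ∃ t, w.state 1 = some t ∧ t ∈ A} := by
  classical
  simp only [ofReal_sem_dia, hA, ofReal_char, Scheduler.measure_next]
  refine le_antisymm (iSup₂_le fun d hd => ?_) (iSup_le fun σ => ?_)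
  · refine le_iSup_of_le (Scheduler.stitch hd fun _ => Classical.arbitrary _) ?_
    simp only [Scheduler.prob_stitch, le_refl]
  · by_cases h : ∃ d, L.trans s d
    · obtain ⟨d, hd, hd'⟩ := σ.exists_choice_eq_some (n := 0) (x := fun _ => s) h
      refine le_iSup₂_of_le d hd ?_
      simp only [Scheduler.prob_of_eq_some hd', le_refl]
    · simp [σ.prob_of_not_trans (n := 0) (x := fun _ => s) h]

lemma ofReal_sem_boxdot_char {φ : Formula AP} {A : Set S} {ρ : ℕ → S → unitInterval}
    (hA : sem L π φ ρ = char A) (s : S) :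
    ENNReal.ofReal (sem L π (boxdot φ) ρ s) =
      ⨅ σ : Scheduler L, σ.measure s {w | ∃ t, w.state 1 = some t ∧ t ∈ A} := by
  classical
  simp only [Scheduler.measure_next]
  by_cases h : ∃ d, L.trans s d
  · simp only [ofReal_sem_boxdot _ _ h, hA, ofReal_char]
    refine le_antisymm (le_iInf fun σ => ?_) (le_iInf₂ fun d hd => ?_)
    · obtain ⟨d, hd, hd'⟩ := σ.exists_choice_eq_some (n := 0) (x := fun _ => s) h
      refine iInf₂_le_of_le d hd ?_
      simp only [Scheduler.prob_of_eq_some hd', le_refl]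
    · refine iInf_le_of_le (Scheduler.stitch hd fun _ => Classical.arbitrary _) ?_
      simp only [Scheduler.prob_stitch, le_refl]
  · simp [sem_boxdot_of_not_trans _ _ h,
      fun σ : Scheduler L => σ.prob_of_not_trans (n := 0) (x := fun _ => s) h]

end Formula

end Optimal

/-! ### Construction of maximal paths -/

section Qualitative

universe u v

variable {S : Type u} {L : PNTS S}

/-- The maximal path from `s` that follows the successor function `nx`. -/
def MaxPath.follow (nx : S → Option S) (h1 : ∀ s t, nx s = some t → L.LeadsTo s t)
    (h2 : ∀ s, nx s = none → ∀ t, ¬ L.LeadsTo s t) (s : S) : MaxPath L where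
  state n := n.rec (some s) fun _ o => o.bind nx
  nonempty := by simp
  initial n h := by simp only at h ⊢; rw [h]; rfl
  step n a b h h' := by
    simp only at h h'
    rw [h] at h'
    exact h1 a b h'
  maximal n a h h' := by
    simp only at h h'
    rw [h] at h'
    exact h2 a h'

lemma MaxPath.follow_state_succ {nx : S → Option S} (h1 : ∀ s t, nx s = some t → L.LeadsTo s t)
    (h2 : ∀ s, nx s = none → ∀ t, ¬ L.LeadsTo s t) (s : S) (n : ℕ) :
    (MaxPath.follow nx h1 h2 s).state (n + 1) = ((MaxPath.follow nx h1 h2 s).state n).bind nx :=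
  rfl

/-- From every state there is a maximal path that avoids `X` as long as it can: it moves to a state
of `X` only from states all of whose successors are in `X`. -/
lemma MaxPath.exists_avoiding (X : Set S) (s : S) :
    ∃ w : MaxPath L, w.state 0 = some s ∧ ∀ n a b, w.state n = some a →
      w.state (n + 1) = some b → b ∈ X → ∀ t, L.LeadsTo a t → t ∈ X := by
  classical
  let nx : S → Option S := fun a =>
    if h : ∃ t, L.LeadsTo a t ∧ t ∉ X then some h.choose
    else if h : ∃ t, L.LeadsTo a t then some h.choose else none
  refine ⟨MaxPath.follow nx (fun a t h => ?_) (fun a h t ht => ?_) s, rfl,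
    fun n a b ha hb hbX t ht => ?_⟩
  · simp only [nx] at h
    split_ifs at h with h1 h2
    · exact Option.some.inj h ▸ h1.choose_spec.1
    · exact Option.some.inj h ▸ h2.choose_spec
  · simp only [nx] at h
    split_ifs at h with h1 h2
    exact h2 ⟨t, ht⟩
  · by_contra htX
    have hex : ∃ t, L.LeadsTo a t ∧ t ∉ X := ⟨t, ht, htX⟩
    have hn : nx a = some hex.choose := by
      simp only [nx]
      rw [dif_pos hex]
    rw [MaxPath.follow_state_succ, ha, Option.bind_some, hn, Option.some.injEq] at hb
    exact hex.choose_spec.2 (hb ▸ hbX)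

lemma MaxPath.exists_state_zero (s : S) : ∃ w : MaxPath L, w.state 0 = some s :=
  (MaxPath.exists_avoiding ∅ s).imp fun _ h => h.1

/-- The maximal path `w` with a predecessor `s` of its first state in front. -/
def MaxPath.cons (s : S) (w : MaxPath L) (h : ∀ t, w.state 0 = some t → L.LeadsTo s t) :
    MaxPath L where
  state n := n.casesOn (some s) w.state
  nonempty := by simp
  initial
    | 0, h' => absurd h' (by simp)
    | n + 1, h' => w.initial n h'
  step
    | 0, a, t, ha, ht => by
      obtain rfl : s = a := Option.some.inj ha
      exact h t ht
    | n + 1, a, t, ha, ht => w.step n a t ha ht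
  maximal
    | 0, _, _, h' => absurd h' w.nonempty
    | n + 1, a, ha, h' => w.maximal n a ha h'

/-- The maximal path `w` without its first state. -/
def MaxPath.tail (w : MaxPath L) (h : w.state 1 ≠ none) : MaxPath L where
  state n := w.state (n + 1)
  nonempty := h
  initial n := w.initial (n + 1)
  step n := w.step (n + 1)
  maximal n := w.maximal (n + 1)

/-! ### Qualitative until formulas -/

variable {B C : Set S}

lemma cons_mem_untilSet {s : S} {w : MaxPath L} {h : ∀ t, w.state 0 = some t → L.LeadsTo s t}
    (hB : s ∈ B) (hw : w ∈ untilSet L B C) : MaxPath.cons s w h ∈ untilSet L B C := by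
  obtain ⟨n, hn, hlt⟩ := hw
  refine ⟨n + 1, hn, fun m hm => ?_⟩
  cases m with
  | zero => exact ⟨s, rfl, hB⟩
  | succ m => exact hlt m (by omega)

lemma mem_untilSet_of_tail {w : MaxPath L} {h : w.state 1 ≠ none} {s : S}
    (h0 : w.state 0 = some s) (hB : s ∈ B) (hw : w.tail h ∈ untilSet L B C) :
    w ∈ untilSet L B C := by
  obtain ⟨n, hn, hlt⟩ := hw
  refine ⟨n + 1, hn, fun m hm => ?_⟩
  cases m with
  | zero => exact ⟨s, h0, hB⟩
  | succ m => exact hlt m (by omega)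

lemma mem_untilSet_of_state_zero_mem {w : MaxPath L} {s : S} (h0 : w.state 0 = some s)
    (hC : s ∈ C) : w ∈ untilSet L B C :=
  ⟨0, ⟨s, h0, hC⟩, by simp⟩

/-- The states from which some maximal path is in `untilSet L B C` belong to every set closed
under the one-step rule for `∃`. -/
lemma mem_of_exists_untilSet {X : Set S} (hC : C ⊆ X)
    (hB : ∀ s ∈ B, ∀ t ∈ X, L.LeadsTo s t → s ∈ X) {s : S} {w : MaxPath L}
    (h0 : w.state 0 = some s) (hw : w ∈ untilSet L B C) : s ∈ X := by
  obtain ⟨n, ⟨t, ht, htC⟩, hlt⟩ := hw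
  have key : ∀ j ≤ n, ∃ a, w.state (n - j) = some a ∧ a ∈ X := by
    intro j
    induction j with
    | zero => exact fun _ => ⟨t, ht, hC htC⟩
    | succ j ih =>
      intro hj
      obtain ⟨a, ha, haX⟩ := ih (by omega)
      obtain ⟨b, hb, hbB⟩ := hlt (n - (j + 1)) (by omega)
      rw [show n - j = n - (j + 1) + 1 by omega] at ha
      exact ⟨b, hb, hB b hbB a haX (w.step _ _ _ hb ha)⟩
  obtain ⟨a, ha, haX⟩ := key n le_rfl
  rw [Nat.sub_self, h0, Option.some.injEq] at ha
  exact ha ▸ haX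

/-- The states from which all maximal paths are in `untilSet L B C` belong to every set closed
under the one-step rule for `∀`: a path that avoids the set as long as it can avoids it forever. -/
lemma mem_of_forall_untilSet {X : Set S} (hC : C ⊆ X)
    (hB : ∀ s ∈ B, (∃ t, L.LeadsTo s t) → (∀ t, L.LeadsTo s t → t ∈ X) → s ∈ X) {s : S}
    (hw : ∀ w : MaxPath L, w.state 0 = some s → w ∈ untilSet L B C) : s ∈ X := by
  by_contra hs
  obtain ⟨w, h0, hav⟩ := MaxPath.exists_avoiding (L := L) X s
  obtain ⟨n, ⟨t, ht, htC⟩, hlt⟩ := hw w h0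
  have key : ∀ j ≤ n, ∀ a, w.state j = some a → a ∉ X := by
    intro j
    induction j with
    | zero =>
      intro _ a ha
      rw [h0, Option.some.injEq] at ha
      exact ha ▸ hs
    | succ j ih =>
      intro hj b hb hbX
      obtain ⟨a, ha, haB⟩ := hlt j (by omega)
      exact ih (by omega) a ha (hB a haB ⟨b, w.step _ _ _ ha hb⟩ (hav j a b ha hb hbX))
  exact key n le_rfl t ht (hC htC)

variable {AP : Type v} {π : AP → S → unitInterval} {φ₁ φ₂ : Formula AP}

namespace Formula

lemma char_le_iff (A : Set S) (f : S → unitInterval) :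
    char A ≤ f ↔ A ⊆ {s | f s = 1} := by
  classical
  constructor
  · intro h s hs
    exact le_antisymm unitInterval.le_one' (by simpa [char_apply, hs] using h s)
  · intro h s
    rw [char_apply]
    split_ifs with hs
    · exact (h hs).ge
    · exact unitInterval.nonneg'

lemma sem_until_posThr (hB : ∀ ρ, sem L π φ₁ ρ = char B) (hC : ∀ ρ, sem L π φ₂ ρ = char C)
    (ρ : ℕ → S → unitInterval) :
    sem L π (.mu 0 (.sup φ₂ (.inf φ₁ (posThr (.dia (.var 0)))))) ρ =
      char {s | ∃ w : MaxPath L, w.state 0 = some s ∧ w ∈ untilSet L B C} := by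
  classical
  refine le_antisymm (sem_mu_le fun s => ?_) ?_
  · by_cases hs : s ∈ {s | ∃ w : MaxPath L, w.state 0 = some s ∧ w ∈ untilSet L B C}
    · rw [char_apply, if_pos hs]
      exact unitInterval.le_one'
    rw [sem_sup_inf hB hC, sem_posThr, char_apply, if_neg hs]
    split_ifs with h1 h2 h3
    · obtain ⟨w, hw⟩ := MaxPath.exists_state_zero (L := L) s
      exact absurd ⟨w, hw, mem_untilSet_of_state_zero_mem hw h1⟩ hs
    · exact le_rfl
    · rw [← ne_eq, sem_dia_ne_zero_iff] at h3
      obtain ⟨t, hst, ht⟩ := h3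
      rw [sem_var, Function.update_self, char_apply, ne_eq, ite_eq_right_iff, Classical.not_imp]
        at ht
      obtain ⟨⟨w, hw, hwU⟩, -⟩ := ht
      refine absurd ⟨MaxPath.cons s w fun a ha => ?_, rfl, cons_mem_untilSet h2 hwU⟩ hs
      rw [hw, Option.some.injEq] at ha
      exact ha ▸ hst
    · exact le_rfl
  · rw [char_le_iff]
    rintro s ⟨w, hw, hwU⟩
    refine mem_of_exists_untilSet (fun t ht => ?_) (fun a ha t ht hat => ?_) hw hwU
    · rw [Set.mem_ofPred_eq, ← sem_mu_eq, sem_sup_inf hB hC, if_pos ht]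
    · rw [Set.mem_ofPred_eq, ← sem_mu_eq, sem_sup_inf hB hC, if_pos ha, sem_posThr]
      refine (ite_congr rfl (fun _ => rfl) fun _ => if_neg ?_).trans (ite_self _)
      rw [← ne_eq, sem_dia_ne_zero_iff]
      refine ⟨t, hat, ?_⟩
      rw [sem_var, Function.update_self, ht]
      exact one_ne_zero

lemma sem_until_oneThr (hB : ∀ ρ, sem L π φ₁ ρ = char B) (hC : ∀ ρ, sem L π φ₂ ρ = char C)
    (ρ : ℕ → S → unitInterval) :
    sem L π (.mu 0 (.sup φ₂ (.inf φ₁ (oneThr (boxdot (.var 0)))))) ρ =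
      char {s | ∀ w : MaxPath L, w.state 0 = some s → w ∈ untilSet L B C} := by
  classical
  refine le_antisymm (sem_mu_le fun s => ?_) ?_
  · by_cases hs : s ∈ {s | ∀ w : MaxPath L, w.state 0 = some s → w ∈ untilSet L B C}
    · rw [char_apply, if_pos hs]
      exact unitInterval.le_one'
    rw [sem_sup_inf hB hC, sem_oneThr, char_apply, if_neg hs]
    split_ifs with h1 h2 h3
    · exact absurd (fun w hw => mem_untilSet_of_state_zero_mem hw h1) hs
    · rw [sem_boxdot_eq_one_iff] at h3
      obtain ⟨⟨t, hst⟩, hall⟩ := h3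
      refine absurd (fun w hw => ?_) hs
      have hne : w.state 1 ≠ none := fun hn => w.maximal 0 s hw hn t hst
      obtain ⟨a, ha⟩ := Option.ne_none_iff_exists'.1 hne
      have hone := hall a (w.step 0 s a hw ha)
      rw [sem_var, Function.update_self, char_apply] at hone
      have haU : a ∈ {s | ∀ w : MaxPath L, w.state 0 = some s → w ∈ untilSet L B C} := by
        by_contra hn
        rw [if_neg hn] at hone
        exact zero_ne_one hone
      exact mem_untilSet_of_tail (h := hne) hw h2 (haU (w.tail hne) ha)
    · exact le_rfl
    · exact le_rfl
  · rw [char_le_iff]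
    intro s hs
    refine mem_of_forall_untilSet (fun t ht => ?_) (fun a ha hex hat => ?_) hs
    · rw [Set.mem_ofPred_eq, ← sem_mu_eq, sem_sup_inf hB hC, if_pos ht]
    · rw [Set.mem_ofPred_eq, ← sem_mu_eq, sem_sup_inf hB hC, if_pos ha, sem_oneThr]
      refine (ite_congr rfl (fun _ => rfl) fun _ => if_pos ?_).trans (ite_self _)
      rw [sem_boxdot_eq_one_iff]
      refine ⟨hex, fun t ht => ?_⟩
      rw [sem_var, Function.update_self]
      exact hat t ht

lemma sem_posThr_dia {φ : Formula AP} {A : Set S} {ρ : ℕ → S → unitInterval}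
    (hA : sem L π φ ρ = char A) :
    sem L π (posThr (.dia φ)) ρ =
      char {s | ∃ w : MaxPath L, w.state 0 = some s ∧ ∃ t, w.state 1 = some t ∧ t ∈ A} := by
  classical
  funext s
  have hiff : sem L π (.dia φ) ρ s = 0 ↔
      ¬ ∃ w : MaxPath L, w.state 0 = some s ∧ ∃ t, w.state 1 = some t ∧ t ∈ A := by
    rw [iff_not_comm, ← ne_eq, sem_dia_ne_zero_iff, hA]
    constructor
    · rintro ⟨w, hw, t, ht, htA⟩
      exact ⟨t, w.step 0 s t hw ht, by simp [char_apply, htA]⟩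
    · rintro ⟨t, hst, ht⟩
      obtain ⟨w, hw⟩ := MaxPath.exists_state_zero (L := L) t
      refine ⟨MaxPath.cons s w fun a ha => ?_, rfl, t, hw, ?_⟩
      · rw [hw, Option.some.injEq] at ha
        exact ha ▸ hst
      · by_contra hn
        simp [char_apply, hn] at ht
  rw [sem_posThr, if_congr hiff rfl rfl, char_apply, ite_not]
  rfl

lemma sem_oneThr_boxdot {φ : Formula AP} {A : Set S} {ρ : ℕ → S → unitInterval}
    (hA : sem L π φ ρ = char A) :
    sem L π (oneThr (boxdot φ)) ρ =
      char {s | ∀ w : MaxPath L, w.state 0 = some s → ∃ t, w.state 1 = some t ∧ t ∈ A} := by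
  classical
  funext s
  have hiff : sem L π (boxdot φ) ρ s = 1 ↔
      ∀ w : MaxPath L, w.state 0 = some s → ∃ t, w.state 1 = some t ∧ t ∈ A := by
    rw [sem_boxdot_eq_one_iff, hA]
    constructor
    · rintro ⟨⟨t, hst⟩, hall⟩ w hw
      obtain ⟨a, ha⟩ := Option.ne_none_iff_exists'.1 fun hn => w.maximal 0 s hw hn t hst
      refine ⟨a, ha, ?_⟩
      have hone := hall a (w.step 0 s a hw ha)
      by_contra hn
      simp [char_apply, hn] at hone
    · intro h
      refine ⟨?_, fun t hst => ?_⟩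
      · obtain ⟨w, hw⟩ := MaxPath.exists_state_zero (L := L) s
        obtain ⟨t, ht, -⟩ := h w hw
        exact ⟨t, w.step 0 s t hw ht⟩
      · obtain ⟨w, hw⟩ := MaxPath.exists_state_zero (L := L) t
        obtain ⟨a, ha, haA⟩ := h (MaxPath.cons s w fun a ha => by
          rw [hw, Option.some.injEq] at ha
          exact ha ▸ hst) rfl
        change w.state 0 = some a at ha
        rw [hw, Option.some.injEq] at ha
        simp [char_apply, ha, haA]
  rw [sem_oneThr, if_congr hiff rfl rfl, char_apply]
  rfl

end Formula

/-! ### Correctness of the encoding -/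

open Formula

/-- A threshold modality over a formula whose value is the probability `p` denotes the set of states
where `p` meets the threshold. -/
lemma sem_thr_eq_char {c : Cmp} {q : Set.Icc (0 : ℚ) 1} {φ : Formula AP}
    {ρ : ℕ → S → unitInterval} {p : S → ℝ≥0∞}
    (hp : ∀ s, ENNReal.ofReal (sem L π φ ρ s) = p s) :
    sem L π (thr c q φ) ρ = char {s | c.Holds (p s) (ENNReal.ofReal ((q : ℚ) : ℝ))} := by
  classical
  funext s
  rw [sem_thr, hp, char_apply]
  rfl

/-- The encoding is correct, for all interpretations of the variables at once: below a
fixed-point operator the subformulas are evaluated at updated interpretations. -/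
theorem sem_encode (ρ : AP → Set S) : ∀ (φ : StateFormula AP) (ν : ℕ → S → unitInterval),
    sem L (fun P => char (ρ P)) φ.encode ν = char (φ.sat L ρ)
  | .tru, ν => by
    rw [StateFormula.encode, StateFormula.sat, sem_one, char, Set.indicator_univ]
  | .prop P, ν => by rw [StateFormula.encode, StateFormula.sat, sem_prop]
  | .neg φ, ν => by
    funext s
    have h := sem_negate (L := L) (π := fun P => char (ρ P)) φ.encode
      fun X x => unitInterval.symm (ν X x)
    simp only [unitInterval.symm_symm] at h
    rw [StateFormula.encode, StateFormula.sat, char_compl, h, sem_encode ρ φ]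
  | .or φ₁ φ₂, ν => by
    funext s
    rw [StateFormula.encode, StateFormula.sat, char_union, sem_sup, sem_encode ρ φ₁,
      sem_encode ρ φ₂]
  | .ex (.next φ), ν => by
    rw [StateFormula.encode, StateFormula.sat, PathFormula.sat]
    exact sem_posThr_dia (sem_encode ρ φ ν)
  | .all (.next φ), ν => by
    rw [StateFormula.encode, StateFormula.sat, PathFormula.sat]
    exact sem_oneThr_boxdot (sem_encode ρ φ ν)
  | .ex (.until φ₁ φ₂), ν => by
    rw [StateFormula.encode, StateFormula.sat, PathFormula.sat]
    exact sem_until_posThr (sem_encode ρ φ₁) (sem_encode ρ φ₂) ν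
  | .all (.until φ₁ φ₂), ν => by
    rw [StateFormula.encode, StateFormula.sat, PathFormula.sat]
    exact sem_until_oneThr (sem_encode ρ φ₁) (sem_encode ρ φ₂) ν
  | .probEx c q (.next φ), ν => by
    rw [StateFormula.encode, StateFormula.sat, PathFormula.sat]
    exact sem_thr_eq_char (ofReal_sem_dia_char (sem_encode ρ φ ν))
  | .probAll c q (.next φ), ν => by
    rw [StateFormula.encode, StateFormula.sat, PathFormula.sat]
    exact sem_thr_eq_char (ofReal_sem_boxdot_char (sem_encode ρ φ ν))
  | .probEx c q (.until φ₁ φ₂), ν => by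
    rw [StateFormula.encode, StateFormula.sat, PathFormula.sat]
    exact sem_thr_eq_char (ofReal_sem_until_dia (sem_encode ρ φ₁) (sem_encode ρ φ₂) ν)
  | .probAll c q (.until φ₁ φ₂), ν => by
    rw [StateFormula.encode, StateFormula.sat, PathFormula.sat]
    exact sem_thr_eq_char (ofReal_sem_until_boxdot (sem_encode ρ φ₁) (sem_encode ρ φ₂) ν)

end Qualitative

end LukPCTL

theorem mainTheorem3 {AP : Type*} {S : Type*} (L : LukPCTL.PNTS S) (ρ : AP → Set S)
    (ν : ℕ → S → unitInterval) (φ : LukPCTL.StateFormula AP) (s : S) :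
    LukPCTL.char (φ.sat L ρ) s =
      LukPCTL.Formula.sem L (fun P => LukPCTL.char (ρ P)) φ.encode ν s := by
  rw [LukPCTL.sem_encode]
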